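/- Let $\mathbb{D}$ be the open unit disc in $\mathbb{C}$, let $dA$ be area measure, and put $\delta_b(z)=1-|z|$. A weight is a measurable function $w$ on $\mathbb{D}$ with $0<w<\infty$ almost everywhere. For $1<q<\infty$, it is called a Bekollé–Bonami weight for the exponent $q$ if there is a constant $C<\infty$ such that \[ \left(\frac{1}{|B|}\int_{B\cap\mathbb{D}} w\,dA\right)\left(\frac{1}{|B|}\int_{B\cap\mathbb{D}} w^{-1/(q-1)}\,dA\right)^{q-1}\le C \] for every open disc $B\subset\mathbb{C}$ whose closure intersects the unit circle. For $0<p<\infty$ let $\|g\|=\left(\int_{\mathbb{D}}|g|^p\,w\,dA\right)^{1/p}$, and let $a^p(w)$ be the space of all real-valued harmonic functions $u$ on $\mathbb{D}$ with $\|u\|<\infty$. **Theorem.** Let $0<p<\infty$ and let $w$ be a Bekollé–Bonami weight for some exponent $q$ with $1<q<\infty$. Suppose that for all sufficiently small $0<\eta<1$ the operators \[ u(z)\mapsto u\bigl(z+e^{i\arg z}\,\eta\,\delta_b(z)\bigr)\qquad\text{and}\qquad u(z)\mapsto u\bigl(z+ie^{i\arg z}\,\eta\,\delta_b(z)\bigr)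 \] are bounded from $a^p(w)$ to $L^p(w\,dA)$; that is, for each such $\eta$ there is a constant $C_\eta<\infty$ such that the image of every $u\in a^p(w)$ has norm at most $C_\eta\|u\|$. Then the operator taking $u$ to its harmonic conjugate $v$, normalized by $v(0)=0$, is bounded on $a^p(w)$: there is a constant $C<\infty$ such that every $u\in a^p(w)$ has a harmonic conjugate $v$ with $v(0)=0$, and this $v$ belongs to $a^p(w)$ and satisfies $\|v\|\le C\|u\|$. -/

import Mathlib

open MeasureTheory Filter Topology
open scoped NNReal ENNReal

/-- The open unit disc, as a set of complex numbers. -/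
abbrev unitDisc : Set ℂ := Metric.ball 0 1

/-- The boundary distance `δ_b(z) = 1 - |z|`. -/
noncomputable def bdist (z : ℂ) : ℝ := 1 - ‖z‖

/-- A Bekollé–Bonami weight with exponent `q`. A weight is a measurable function on the unit disc
that is positive and finite almost everywhere. The discs `B` range over all discs of the plane whose
closure meets the unit circle; since `w` lives on the unit disc, the integrals over `B` are over the
part of `B` that lies in the unit disc. The averages are `[0, ∞]`-valued, so the bound includes the
finiteness of both integrals. -/
structure IsBekolleBonami (q : ℝ) (w : ℂ → ℝ) : Prop where
  aemeasurable : AEMeasurable w (volume.restrict unitDisc)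
  pos : ∀ᵐ z ∂(volume.restrict unitDisc), 0 < w z
  bound : ∃ C : ℝ≥0, ∀ (a : ℂ) (r : ℝ), 0 < r →
    (closure (Metric.ball a r) ∩ Metric.sphere 0 1).Nonempty →
    ((volume (Metric.ball a r))⁻¹ * ∫⁻ z in Metric.ball a r ∩ unitDisc, ENNReal.ofReal (w z)) *
      ((volume (Metric.ball a r))⁻¹ *
        ∫⁻ z in Metric.ball a r ∩ unitDisc, ENNReal.ofReal (w z ^ (-1 / (q - 1)))) ^ (q - 1) ≤ C

/-- The measure `w dA` on the unit disc. -/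
noncomputable def weightedArea (w : ℂ → ℝ) : Measure ℂ :=
  (volume.restrict unitDisc).withDensity fun z => ENNReal.ofReal (w z)

/-- Membership in the weighted harmonic Bergman space: `u` is a real harmonic function on the unit
disc that lies in `L^p(w dA)`. -/
def MemHarmonicBergman (p : ℝ) (w : ℂ → ℝ) (u : ℂ → ℝ) : Prop :=
  InnerProductSpace.HarmonicOnNhd u unitDisc ∧ MemLp u (ENNReal.ofReal p) (weightedArea w)

/-- The map `z ↦ z + e^{i arg z} η δ_b(z)` of the unit disc. -/
noncomputable def radialShift (η : ℝ) (z : ℂ) : ℂ :=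
  z + Complex.exp (Complex.I * Complex.arg z) * η * bdist z

/-- The map `z ↦ z + i e^{i arg z} η δ_b(z)` of the unit disc. -/
noncomputable def angularShift (η : ℝ) (z : ℂ) : ℂ :=
  z + Complex.I * Complex.exp (Complex.I * Complex.arg z) * η * bdist z

/-- The composition operator `u ↦ u ∘ φ` is bounded from the weighted harmonic Bergman space into
`L^p(w dA)`. -/
def CompositionBounded (p : ℝ) (w : ℂ → ℝ) (φ : ℂ → ℂ) : Prop :=
  ∃ C : ℝ≥0, ∀ u : ℂ → ℝ, MemHarmonicBergman p w u →
    eLpNorm (u ∘ φ) (ENNReal.ofReal p) (weightedArea w) ≤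
      C * eLpNorm u (ENNReal.ofReal p) (weightedArea w)

/-- `v` is the harmonic conjugate of `u` on the unit disc, normalized by `v 0 = 0`:
`u + i v` is analytic on the unit disc. -/
def IsHarmonicConjugate (u v : ℂ → ℝ) : Prop :=
  DifferentiableOn ℂ (fun z => (u z : ℂ) + Complex.I * (v z : ℂ)) unitDisc ∧ v 0 = 0

/-! The conjugate `v` is controlled along each ray by the sizes of `u` at dyadic distances from the
circle, and the weight makes these contributions summable.

Local estimate: for harmonic `u` and every `s > 0`, `|u| ^ s` satisfies a sub-mean value inequality
up to a constant (Hardy–Littlewood). Taking `s = p / q` and using Hölder with the Bekollé–Bonami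
condition gives `IsBekolleBonami.exists_enorm_rpow_mul_le`: `|u ξ| ^ p` times the weighted area of a
comparable disc meeting the circle is at most a constant times the integral of `|u| ^ p w` near `ξ`.

Weight: tested on indicators, the same condition is of `A_∞` type. The top half of a Carleson box
carries a fixed proportion of its weighted area, so the part within `2 ^ (-n-m)` of the circle in a
box of generation `n` has proportion at most `ρ ^ m`, `ρ < 1`
(`IsBekolleBonami.exists_dyadicBox_decay`).

Conjugate: Borel–Carathéodory on discs of Whitney size, chained along the ray from `0`, bounds `|v
z|` by the sum of the suprema of `|u|` near the ray, one for each generation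
(`IsHarmonicConjugate.enorm_le_sum`). A discrete Hardy inequality moves the power `p` inside this
sum at the price of factors `θ ^ (-(N-n))`, where `θ ^ 2 ≥ ρ`. Integration over the layer of
generation `N` gains `ρ ^ (N-n)`, leaving `θ ^ (N-n)`, which is summable in `N`. The local estimate
and bounded overlap turn the remaining sum over boxes into the integral of `|u| ^ p w`. -/

/-! ### Mean value inequalities for powers of harmonic functions -/

/-- Circular mean value inequality in `lintegral` form. -/
theorem enorm_mul_le_lintegral_circle {u : ℂ → ℝ} {a : ℂ} {ρ : ℝ} (hρ : 0 ≤ ρ)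
    (hu : InnerProductSpace.HarmonicOnNhd u (Metric.closedBall a ρ)) :
    ENNReal.ofReal (2 * Real.pi) * ‖u a‖ₑ ≤
      ∫⁻ θ in Set.Ioo (-Real.pi) Real.pi, ‖u (circleMap a ρ θ)‖ₑ := by
  have h1 := InnerProductSpace.HarmonicOnNhd.circleAverage_eq (f := u) (c := a) (R := ρ)
    (by rwa [abs_of_nonneg hρ])
  have h2 : ∫ θ in (-Real.pi)..Real.pi, u (circleMap a ρ θ) = 2 * Real.pi * u a := by
    have h3 : ∫ θ in (-Real.pi)..Real.pi, u (circleMap a ρ θ) =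
        ∫ θ in (0 : ℝ)..(2 * Real.pi), u (circleMap a ρ θ) := by
      have hper : Function.Periodic (fun θ => u (circleMap a ρ θ)) (2 * Real.pi) := fun θ => by
        simp only [periodic_circleMap a ρ θ]
      have := hper.intervalIntegral_add_eq (-Real.pi) 0
      rw [show -Real.pi + 2 * Real.pi = Real.pi by ring, zero_add] at this
      exact this
    rw [h3, ← h1, Real.circleAverage_def, smul_eq_mul]
    field_simp
  rw [intervalIntegral.integral_of_le (by linarith [Real.pi_pos]), integral_Ioc_eq_integral_Ioo]
    at h2
  calc ENNReal.ofReal (2 * Real.pi) * ‖u a‖ₑ = ‖2 * Real.pi * u a‖ₑ := by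
        rw [enorm_mul, Real.enorm_of_nonneg (r := 2 * Real.pi) (by positivity)]
    _ ≤ _ := by rw [← h2]; exact enorm_integral_le_lintegral_enorm _

/-- Area mean value inequality. -/
theorem enorm_mul_le_lintegral_ball {u : ℂ → ℝ} {a : ℂ} {r : ℝ} (hr : 0 < r)
    (hu : InnerProductSpace.HarmonicOnNhd u (Metric.ball a r)) :
    ENNReal.ofReal (Real.pi * r ^ 2) * ‖u a‖ₑ ≤ ∫⁻ z in Metric.ball a r, ‖u z‖ₑ := by
  classical
  set g : ℂ → ℝ≥0∞ := (Metric.ball a r).indicator fun z => ‖u z‖ₑ with hg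
  have hmeas : Measurable g := by
    have : Measurable ((Metric.ball a r).indicator u) := by
      rw [← Set.piecewise_eq_indicator]
      exact hu.continuousOn.measurable_piecewise continuousOn_const Metric.isOpen_ball.measurableSet
    have h2 : g = fun z => ‖(Metric.ball a r).indicator u z‖ₑ := by
      ext z
      by_cases hz : z ∈ Metric.ball a r <;> simp [hg, hz]
    rw [h2]
    exact this.enorm
  have hpi := Real.pi_pos
  rw [← lintegral_indicator Metric.isOpen_ball.measurableSet, ← hg,
    ← lintegral_add_left_eq_self g a, ← Complex.lintegral_comp_polarCoord_symm]
  have hm2 : Measurable fun p : ℝ × ℝ => ENNReal.ofReal p.1 • g (a + Complex.polarCoord.symm p) := by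
    simp only [Complex.polarCoord_symm_apply, smul_eq_mul]
    refine Measurable.mul (by fun_prop) (hmeas.comp ?_)
    fun_prop
  rw [polarCoord_target, Measure.volume_eq_prod, setLIntegral_prod _ hm2.aemeasurable]
  calc ENNReal.ofReal (Real.pi * r ^ 2) * ‖u a‖ₑ
      = ∫⁻ ρ in Set.Ioo 0 r, ENNReal.ofReal ρ * (ENNReal.ofReal (2 * Real.pi) * ‖u a‖ₑ) := by
        rw [lintegral_mul_const _ (by fun_prop)]
        have : ∫⁻ ρ in Set.Ioo 0 r, ENNReal.ofReal ρ = ENNReal.ofReal (r ^ 2 / 2) := by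
          rw [← ofReal_integral_eq_lintegral_ofReal]
          · rw [← integral_Ioc_eq_integral_Ioo, ← intervalIntegral.integral_of_le hr.le,
              integral_id]
            simp
          · exact (continuous_id.integrableOn_Icc).mono_set Set.Ioo_subset_Icc_self
          · filter_upwards [ae_restrict_mem measurableSet_Ioo] with x hx using hx.1.le
        rw [this, ← mul_assoc, ← ENNReal.ofReal_mul (by positivity)]
        congr 2
        ring
    _ ≤ ∫⁻ ρ in Set.Ioo 0 r, ∫⁻ θ in Set.Ioo (-Real.pi) Real.pi,
          ENNReal.ofReal ρ • g (a + Complex.polarCoord.symm (ρ, θ)) := by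
        refine setLIntegral_mono' measurableSet_Ioo fun ρ hρ => ?_
        simp only [smul_eq_mul]
        rw [lintegral_const_mul' _ _ ENNReal.ofReal_ne_top]
        gcongr
        refine (enorm_mul_le_lintegral_circle hρ.1.le
          (hu.mono (Metric.closedBall_subset_ball hρ.2))).trans (le_of_eq ?_)
        refine lintegral_congr fun θ => ?_
        have h4 : a + Complex.polarCoord.symm (ρ, θ) = circleMap a ρ θ := by
          simp [circleMap, Complex.exp_mul_I]
        have h5 : circleMap a ρ θ ∈ Metric.ball a r :=
          Metric.sphere_subset_closedBall.trans (Metric.closedBall_subset_ball hρ.2)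
            (circleMap_mem_sphere a hρ.1.le θ)
        rw [h4, hg, Set.indicator_of_mem h5]
    _ ≤ _ := lintegral_mono_set fun x hx => hx.1

theorem mul_le_setIntegral_ball {u : ℂ → ℝ} {a : ℂ} {r : ℝ} (hr : 0 < r)
    (hu : InnerProductSpace.HarmonicOnNhd u (Metric.closedBall a r)) :
    Real.pi * r ^ 2 * |u a| ≤ ∫ z in Metric.ball a r, |u z| := by
  have h := enorm_mul_le_lintegral_ball hr (hu.mono Metric.ball_subset_closedBall)
  have hint : IntegrableOn u (Metric.ball a r) :=
    (hu.continuousOn.integrableOn_compact (isCompact_closedBall a r)).mono_set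
      Metric.ball_subset_closedBall
  simp only [← Real.norm_eq_abs]
  rw [← ENNReal.ofReal_le_ofReal_iff (integral_nonneg fun _ => norm_nonneg _),
    ofReal_integral_norm_eq_lintegral_enorm hint, ENNReal.ofReal_mul (by positivity),
    ofReal_norm]
  exact h

/-- When `y > x / 2` the factor `(2 * y / x) ^ s` exceeds `1`, so it can be inserted into `A * x`.
This trades `y` for `y ^ s` plus a term small enough to be absorbed. -/
theorem le_half_add_rpow {s A x y : ℝ} (hs : 0 < s) (hA : 1 ≤ A) (hx : 0 < x) (hy : 0 ≤ y)
    (hyx : y ≤ A * x) : y ≤ x / 2 + A * 2 ^ s * x ^ (1 - s) * y ^ s := by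
  rcases le_or_gt y (x / 2) with h | h
  · have : 0 ≤ A * 2 ^ s * x ^ (1 - s) * y ^ s := by positivity
    linarith
  · have h1 : 1 ≤ 2 ^ s * y ^ s / x ^ s := by
      rw [← Real.mul_rpow (by norm_num) hy, ← Real.div_rpow (by positivity) hx.le]
      exact Real.one_le_rpow (by rw [le_div_iff₀ hx]; linarith) hs.le
    have h2 : A * 2 ^ s * x ^ (1 - s) * y ^ s = A * x * (2 ^ s * y ^ s / x ^ s) := by
      rw [Real.rpow_sub hx, Real.rpow_one]
      field_simp
    rw [h2]
    nlinarith [mul_pos (lt_of_lt_of_le one_pos hA) hx]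

/-- Hardy–Littlewood: the sub-mean value inequality for `|u| ^ s` with any exponent `s > 0`. -/
theorem exists_rpow_mul_sq_le_setIntegral (s : ℝ) (hs : 0 < s) :
    ∃ C : ℝ, 0 < C ∧ ∀ (u : ℂ → ℝ) (a : ℂ) (r : ℝ), 0 < r →
      InnerProductSpace.HarmonicOnNhd u (Metric.closedBall a r) →
      |u a| ^ s * r ^ 2 ≤ C * ∫ z in Metric.ball a r, |u z| ^ s := by
  -- Chosen so that `A ^ s = 4`, the loss in halving the distance to the boundary in `φ` below.
  set A : ℝ := 2 ^ (2 / s) with hA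
  have hA1 : 1 ≤ A := Real.one_le_rpow (by norm_num) (by positivity)
  have hpi := Real.pi_pos
  refine ⟨8 / Real.pi * (A * 2 ^ s), by positivity, fun u a r hr hu => ?_⟩
  have hcs : ContinuousOn (fun z => |u z| ^ s) (Metric.closedBall a r) :=
    hu.continuousOn.abs.rpow_const fun _ _ => Or.inr hs.le
  have hints : IntegrableOn (fun z => |u z| ^ s) (Metric.closedBall a r) :=
    hcs.integrableOn_compact (isCompact_closedBall a r)
  rcases eq_or_ne (u a) 0 with h0 | h0
  · rw [h0, abs_zero, Real.zero_rpow hs.ne', zero_mul]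
    exact mul_nonneg (by positivity) (integral_nonneg fun z => by positivity)
  -- `φ` vanishes on the boundary circle, so its maximum `z₀` is interior. Maximality gives `|u| ≤ A
  -- * |u z₀|` on the disc about `z₀` of half the distance to that circle.
  set φ : ℂ → ℝ := fun z => (r - ‖z - a‖) ^ 2 * |u z| ^ s with hφ
  have hφc : ContinuousOn φ (Metric.closedBall a r) := ContinuousOn.mul (by fun_prop) hcs
  obtain ⟨z₀, hz₀, hmax⟩ := (isCompact_closedBall a r).exists_isMaxOn
    ⟨a, Metric.mem_closedBall_self hr.le⟩ hφc
  have hφa : φ a = |u a| ^ s * r ^ 2 := by simp [hφ, mul_comm]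
  have hφa0 : 0 < φ a := by rw [hφa]; positivity
  have hle : φ a ≤ φ z₀ := hmax (Metric.mem_closedBall_self hr.le)
  set d := r - ‖z₀ - a‖ with hd
  have hd0 : 0 ≤ d := by
    rw [mem_closedBall_iff_norm] at hz₀
    linarith
  have hdpos : 0 < d := by
    rcases hd0.eq_or_lt with h | h
    · have : φ z₀ = 0 := by simp only [hφ, ← hd, ← h]; simp
      linarith
    · exact h
  have hu0 : 0 < |u z₀| := by
    rw [abs_pos]
    intro h
    have : φ z₀ = 0 := by simp [hφ, h, Real.zero_rpow hs.ne']
    linarith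
  have hsub : Metric.closedBall z₀ (d / 2) ⊆ Metric.closedBall a r := by
    refine Metric.closedBall_subset_closedBall' ?_
    rw [dist_eq_norm]
    linarith
  have hpt : ∀ z ∈ Metric.ball z₀ (d / 2),
      |u z| ≤ |u z₀| / 2 + A * 2 ^ s * |u z₀| ^ (1 - s) * |u z| ^ s := by
    intro z hz
    refine le_half_add_rpow hs hA1 hu0 (abs_nonneg _) ?_
    have hz' := hsub (Metric.ball_subset_closedBall hz)
    have hm : φ z ≤ φ z₀ := hmax hz'
    have hdz : d / 2 ≤ r - ‖z - a‖ := by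
      have : ‖z - a‖ ≤ ‖z - z₀‖ + ‖z₀ - a‖ := norm_sub_le_norm_sub_add_norm_sub z z₀ a
      rw [mem_ball_iff_norm] at hz
      linarith
    have h1 : (d / 2) ^ 2 * |u z| ^ s ≤ d ^ 2 * |u z₀| ^ s := by
      refine le_trans ?_ hm
      simp only [hφ]
      gcongr
    have h2 : |u z| ^ s ≤ 4 * |u z₀| ^ s := by
      have : 0 < d ^ 2 := by positivity
      nlinarith
    have h3 : (4 : ℝ) * |u z₀| ^ s = (A * |u z₀|) ^ s := by
      rw [Real.mul_rpow (by positivity) (abs_nonneg _), hA, ← Real.rpow_mul (by norm_num)]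
      rw [div_mul_cancel₀ _ hs.ne']
      norm_num
    rw [h3] at h2
    exact (Real.rpow_le_rpow_iff (abs_nonneg _) (by positivity) hs).1 h2
  have hmean := mul_le_setIntegral_ball (half_pos hdpos) (hu.mono hsub)
  have hintb : IntegrableOn (fun z => |u z| ^ s) (Metric.ball z₀ (d / 2)) :=
    hints.mono_set (Metric.ball_subset_closedBall.trans hsub)
  have hvol : volume.real (Metric.ball z₀ (d / 2)) = Real.pi * (d / 2) ^ 2 := by
    rw [Measure.real, Complex.volume_ball]
    simp [ENNReal.toReal_ofReal (half_pos hdpos).le, mul_comm]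
  have hconst : IntegrableOn (fun _ : ℂ => |u z₀| / 2) (Metric.ball z₀ (d / 2)) :=
    integrableOn_const (by simp [Complex.volume_ball, ENNReal.mul_eq_top])
  have hI : ∫ z in Metric.ball z₀ (d / 2), |u z| ≤
      Real.pi * (d / 2) ^ 2 * (|u z₀| / 2) +
        A * 2 ^ s * |u z₀| ^ (1 - s) * ∫ z in Metric.ball z₀ (d / 2), |u z| ^ s := by
    calc ∫ z in Metric.ball z₀ (d / 2), |u z|
        ≤ ∫ z in Metric.ball z₀ (d / 2),
            (|u z₀| / 2 + A * 2 ^ s * |u z₀| ^ (1 - s) * |u z| ^ s) := by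
          refine setIntegral_mono_on ?_ (hconst.add (hintb.const_mul _))
            Metric.isOpen_ball.measurableSet hpt
          exact ((hu.continuousOn.abs.integrableOn_compact (isCompact_closedBall a r)).mono_set
            (Metric.ball_subset_closedBall.trans hsub))
      _ = _ := by
          rw [integral_add hconst (hintb.const_mul _), integral_const_mul, setIntegral_const, hvol,
            smul_eq_mul]
  have hJ : ∫ z in Metric.ball z₀ (d / 2), |u z| ^ s ≤ ∫ z in Metric.ball a r, |u z| ^ s := by
    refine setIntegral_mono_set (hints.mono_set Metric.ball_subset_closedBall)
      (Eventually.of_forall fun z => by positivity) (LE.le.eventuallyLE ?_)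
    refine Metric.ball_subset_ball' ?_
    rw [dist_eq_norm]
    linarith
  set J := ∫ z in Metric.ball z₀ (d / 2), |u z| ^ s with hJdef
  -- The term `|u z₀| / 2` of `hpt` is absorbed: it takes half of `π (d / 2) ^ 2 |u z₀|`.
  have h6 : Real.pi * d ^ 2 / 8 * |u z₀| ≤ A * 2 ^ s * |u z₀| ^ (1 - s) * J := by
    nlinarith
  have h7 : φ z₀ ≤ 8 / Real.pi * (A * 2 ^ s) * J := by
    have h8 : |u z₀| ^ (1 - s) * |u z₀| ^ s = |u z₀| := by
      rw [← Real.rpow_add hu0]; simp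
    have h9 : 0 < |u z₀| ^ (1 - s) := by positivity
    have h10 : |u z₀| ^ (1 - s) * (Real.pi * d ^ 2 / 8 * |u z₀| ^ s) ≤
        |u z₀| ^ (1 - s) * (A * 2 ^ s * J) := by
      calc _ = Real.pi * d ^ 2 / 8 * (|u z₀| ^ (1 - s) * |u z₀| ^ s) := by ring
        _ ≤ _ := by rw [h8]; linarith
    have h11 := le_of_mul_le_mul_left h10 h9
    calc φ z₀ = 8 / Real.pi * (Real.pi * d ^ 2 / 8 * |u z₀| ^ s) := by
          simp only [hφ, ← hd]; field_simp
      _ ≤ 8 / Real.pi * (A * 2 ^ s * J) := by gcongr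
      _ = _ := by ring
  rw [← hφa]
  refine hle.trans (h7.trans ?_)
  gcongr

/-- Hardy–Littlewood: the sub-mean value inequality for `|u| ^ s` with any exponent `s > 0`. -/
theorem exists_enorm_rpow_mul_sq_le_lintegral (s : ℝ) (hs : 0 < s) :
    ∃ C : ℝ≥0, ∀ (u : ℂ → ℝ) (a : ℂ) (r : ℝ), 0 < r →
      InnerProductSpace.HarmonicOnNhd u (Metric.closedBall a r) →
      ‖u a‖ₑ ^ s * ENNReal.ofReal r ^ 2 ≤ C * ∫⁻ z in Metric.ball a r, ‖u z‖ₑ ^ s := by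
  obtain ⟨C, hC, h⟩ := exists_rpow_mul_sq_le_setIntegral s hs
  refine ⟨C.toNNReal, fun u a r hr hu => ?_⟩
  have hints : IntegrableOn (fun z => |u z| ^ s) (Metric.ball a r) :=
    ((hu.continuousOn.abs.rpow_const fun _ _ => Or.inr hs.le).integrableOn_compact
      (isCompact_closedBall a r)).mono_set Metric.ball_subset_closedBall
  have key : ∀ z, ‖u z‖ₑ ^ s = ENNReal.ofReal (|u z| ^ s) := fun z => by
    rw [← ENNReal.ofReal_rpow_of_nonneg (abs_nonneg _) hs.le, Real.enorm_eq_ofReal_abs]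
  simp only [key]
  rw [← ofReal_integral_eq_lintegral_ofReal hints (Eventually.of_forall fun z => by positivity),
    ← ENNReal.ofReal_pow hr.le, ← ENNReal.ofReal_mul (by positivity), ENNReal.ofNNReal_toNNReal,
    ← ENNReal.ofReal_mul hC.le]
  exact ENNReal.ofReal_le_ofReal (h u a r hr hu)

/-! ### Consequences of the Bekollé–Bonami condition -/

theorem IsBekolleBonami.aemeasurable_ofReal {q : ℝ} {w : ℂ → ℝ} (hw : IsBekolleBonami q w) :
    AEMeasurable (fun z => ENNReal.ofReal (w z)) (volume.restrict unitDisc) :=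
  hw.aemeasurable.ennreal_ofReal

theorem weightedArea_apply {w : ℂ → ℝ} {E : Set ℂ} (hE : MeasurableSet E) :
    weightedArea w E = ∫⁻ z in E ∩ unitDisc, ENNReal.ofReal (w z) := by
  rw [weightedArea, withDensity_apply _ hE, Measure.restrict_restrict hE]

theorem IsBekolleBonami.setLIntegral_weightedArea {q : ℝ} {w : ℂ → ℝ} (hw : IsBekolleBonami q w)
    {E : Set ℂ} (hE : MeasurableSet E) (hED : E ⊆ unitDisc) {g : ℂ → ℝ≥0∞}
    (hg : AEMeasurable g (volume.restrict E)) :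
    ∫⁻ z in E, g z ∂(weightedArea w) = ∫⁻ z in E, ENNReal.ofReal (w z) * g z := by
  have hr : (weightedArea w).restrict E =
      (volume.restrict E).withDensity fun z => ENNReal.ofReal (w z) := by
    rw [weightedArea, restrict_withDensity hE, Measure.restrict_restrict hE,
      Set.inter_eq_left.2 hED]
  rw [hr, lintegral_withDensity_eq_lintegral_mul₀ _ hg]
  · rfl
  · exact hw.aemeasurable_ofReal.mono_measure (Measure.restrict_mono hED le_rfl)

/-- The Bekollé–Bonami condition tested against a function: Hölder's inequality lets one pass
from unweighted means to weighted means. -/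
theorem IsBekolleBonami.exists_lintegral_rpow_mul_le {q : ℝ} (hq : 1 < q) {w : ℂ → ℝ}
    (hw : IsBekolleBonami q w) :
    ∃ C : ℝ≥0, ∀ (e : ℂ) (R : ℝ), 0 < R →
      (closure (Metric.ball e R) ∩ Metric.sphere 0 1).Nonempty →
      ∀ E : Set ℂ, MeasurableSet E → E ⊆ Metric.ball e R ∩ unitDisc →
      ∀ g : ℂ → ℝ≥0∞, AEMeasurable g (volume.restrict E) →
        (∫⁻ z in E, g z) ^ q * weightedArea w (Metric.ball e R) ≤
          C * volume (Metric.ball e R) ^ q * ∫⁻ z in E, g z ^ q ∂(weightedArea w) := by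
  obtain ⟨C, hC⟩ := hw.bound
  refine ⟨C, fun e R hR hne E hE hEB g hg => ?_⟩
  have hq0 : 0 < q := by linarith
  have hq1 : 0 < q - 1 := by linarith
  have hED : E ⊆ unitDisc := fun z hz => (hEB hz).2
  have hle : volume.restrict E ≤ volume.restrict unitDisc := Measure.restrict_mono hED le_rfl
  set W : ℂ → ℝ≥0∞ := fun z => ENNReal.ofReal (w z) with hW
  set σ : ℂ → ℝ≥0∞ := fun z => ENNReal.ofReal (w z ^ (-1 / (q - 1))) with hσ
  have hWm : AEMeasurable W (volume.restrict E) := hw.aemeasurable_ofReal.mono_measure hle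
  have hσm : AEMeasurable σ (volume.restrict E) :=
    ((hw.aemeasurable.pow_const _).ennreal_ofReal).mono_measure hle
  have hconj : q.HolderConjugate (q / (q - 1)) := Real.HolderConjugate.conjExponent hq
  -- Insert `1 = w ^ (1 / q) * σ ^ ((q - 1) / q)`, valid almost everywhere, and give the second
  -- factor the conjugate exponent, so that its integral becomes that of `σ`.
  have hholder := ENNReal.lintegral_mul_le_Lp_mul_Lq (volume.restrict E) hconj
    (f := fun z => W z ^ (1 / q) * g z) (g := fun z => σ z ^ ((q - 1) / q))
    ((hWm.pow_const _).mul hg) (hσm.pow_const _)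
  have hleft : ∫⁻ z in E, ((fun z => W z ^ (1 / q) * g z) * fun z => σ z ^ ((q - 1) / q)) z =
      ∫⁻ z in E, g z := by
    refine lintegral_congr_ae ?_
    filter_upwards [ae_mono hle hw.pos] with z hz
    have h1 : W z ^ (1 / q) * σ z ^ ((q - 1) / q) = 1 := by
      simp only [hW, hσ]
      rw [ENNReal.ofReal_rpow_of_pos hz, ENNReal.ofReal_rpow_of_pos (by positivity),
        ← ENNReal.ofReal_mul (by positivity), ← Real.rpow_mul hz.le, ← Real.rpow_add hz]
      have : 1 / q + -1 / (q - 1) * ((q - 1) / q) = 0 := by field_simp; ring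
      rw [this]; simp
    simp only [Pi.mul_apply]
    calc W z ^ (1 / q) * g z * σ z ^ ((q - 1) / q)
        = (W z ^ (1 / q) * σ z ^ ((q - 1) / q)) * g z := by ring
      _ = g z := by rw [h1, one_mul]
  have hf : ∀ z, (W z ^ (1 / q) * g z) ^ q = W z * g z ^ q := fun z => by
    rw [ENNReal.mul_rpow_of_nonneg _ _ hq0.le, ← ENNReal.rpow_mul, one_div_mul_cancel hq0.ne',
      ENNReal.rpow_one]
  have hs : ∀ z, (σ z ^ ((q - 1) / q)) ^ (q / (q - 1)) = σ z := fun z => by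
    rw [← ENNReal.rpow_mul]
    have : (q - 1) / q * (q / (q - 1)) = 1 := by field_simp
    rw [this, ENNReal.rpow_one]
  rw [hleft] at hholder
  simp only [hf, hs] at hholder
  rw [← hw.setLIntegral_weightedArea hE hED (hg.pow_const _)] at hholder
  have hpow := ENNReal.rpow_le_rpow hholder hq0.le
  rw [ENNReal.mul_rpow_of_nonneg _ _ hq0.le, ← ENNReal.rpow_mul, ← ENNReal.rpow_mul,
    one_div_mul_cancel hq0.ne', ENNReal.rpow_one,
    show 1 / (q / (q - 1)) * q = q - 1 by field_simp] at hpow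
  have hBC := hC e R hR hne
  have hvol0 : volume (Metric.ball e R) ≠ 0 := (Metric.measure_ball_pos _ _ hR).ne'
  have hvolt : volume (Metric.ball e R) ≠ ⊤ := measure_ball_lt_top.ne
  rw [weightedArea_apply Metric.isOpen_ball.measurableSet]
  set V := volume (Metric.ball e R)
  set I := ∫⁻ z in Metric.ball e R ∩ unitDisc, ENNReal.ofReal (w z)
  have hmono : ∫⁻ z in E, σ z ≤ ∫⁻ z in Metric.ball e R ∩ unitDisc, σ z := lintegral_mono_set hEB
  set S := ∫⁻ z in Metric.ball e R ∩ unitDisc, σ z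
  -- The Bekollé–Bonami bound with denominators cleared: the averages contribute `V * V ^ (q - 1) =
  -- V ^ q`.
  have hIS : I * S ^ (q - 1) ≤ C * V ^ q := by
    have h1 : V ^ q * (V⁻¹ * I * (V⁻¹ * S) ^ (q - 1)) = I * S ^ (q - 1) := by
      rw [ENNReal.mul_rpow_of_nonneg _ _ hq1.le, ENNReal.inv_rpow]
      have h2 : V ^ q = V * V ^ (q - 1) := by
        conv_rhs => rw [← ENNReal.rpow_one V, ← ENNReal.rpow_mul, one_mul,
          ← ENNReal.rpow_add _ _ hvol0 hvolt]
        congr 1; ring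
      have h3 : V ^ (q - 1) ≠ 0 := by simp [ENNReal.rpow_eq_zero_iff, hvol0, hvolt]
      have h4 : V ^ (q - 1) ≠ ⊤ := ENNReal.rpow_ne_top_of_nonneg hq1.le hvolt
      rw [h2]
      calc V * V ^ (q - 1) * (V⁻¹ * I * ((V ^ (q - 1))⁻¹ * S ^ (q - 1)))
          = (V * V⁻¹) * (V ^ (q - 1) * (V ^ (q - 1))⁻¹) * (I * S ^ (q - 1)) := by ring
        _ = _ := by rw [ENNReal.mul_inv_cancel hvol0 hvolt, ENNReal.mul_inv_cancel h3 h4]; simp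
    rw [← h1, mul_comm (C : ℝ≥0∞)]
    gcongr
  calc (∫⁻ z in E, g z) ^ q * I
      ≤ ((∫⁻ z in E, g z ^ q ∂(weightedArea w)) * (∫⁻ z in E, σ z) ^ (q - 1)) * I := by
        gcongr
    _ ≤ ((∫⁻ z in E, g z ^ q ∂(weightedArea w)) * S ^ (q - 1)) * I := by gcongr
    _ = (I * S ^ (q - 1)) * ∫⁻ z in E, g z ^ q ∂(weightedArea w) := by ring
    _ ≤ _ := by gcongr

/-- Weighted measure of subsets: Bekollé–Bonami weights satisfy an `A_∞` condition. -/
theorem IsBekolleBonami.exists_volume_rpow_mul_le {q : ℝ} (hq : 1 < q) {w : ℂ → ℝ}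
    (hw : IsBekolleBonami q w) :
    ∃ C : ℝ≥0, ∀ (e : ℂ) (R : ℝ), 0 < R →
      (closure (Metric.ball e R) ∩ Metric.sphere 0 1).Nonempty →
      ∀ E : Set ℂ, MeasurableSet E → E ⊆ Metric.ball e R ∩ unitDisc →
        volume E ^ q * weightedArea w (Metric.ball e R) ≤
          C * volume (Metric.ball e R) ^ q * weightedArea w E := by
  obtain ⟨C, hC⟩ := hw.exists_lintegral_rpow_mul_le hq
  refine ⟨C, fun e R hR hne E hE hEB => ?_⟩
  simpa using hC e R hR hne E hE hEB (fun _ => 1) aemeasurable_const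

/-- Local `L^p` bound for harmonic functions on a small disc, compared with a large disc meeting
the unit circle. -/
theorem IsBekolleBonami.exists_enorm_rpow_mul_le {p q : ℝ} (hp : 0 < p) (hq : 1 < q) {w : ℂ → ℝ}
    (hw : IsBekolleBonami q w) :
    ∃ C : ℝ≥0, ∀ (e : ℂ) (R : ℝ), 0 < R →
      (closure (Metric.ball e R) ∩ Metric.sphere 0 1).Nonempty →
      ∀ (u : ℂ → ℝ) (ξ : ℂ) (r : ℝ), 0 < r → Metric.ball ξ r ⊆ Metric.ball e R →
        Metric.closedBall ξ r ⊆ unitDisc → InnerProductSpace.HarmonicOnNhd u unitDisc →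
        ENNReal.ofReal (r ^ 2) ^ q * (‖u ξ‖ₑ ^ p * weightedArea w (Metric.ball e R)) ≤
          C * volume (Metric.ball e R) ^ q *
            ∫⁻ z in Metric.ball ξ r, ‖u z‖ₑ ^ p ∂(weightedArea w) := by
  have hq0 : 0 < q := by linarith
  obtain ⟨C₁, hC₁⟩ := hw.exists_lintegral_rpow_mul_le hq
  -- The exponent `p / q` becomes `p` after the `q`-th power in Hölder's inequality.
  obtain ⟨C₂, hC₂⟩ := exists_enorm_rpow_mul_sq_le_lintegral (p / q) (by positivity)
  refine ⟨C₂ ^ q * C₁, fun e R hR hne u ξ r hr hsub hD hu => ?_⟩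
  have hm : AEMeasurable (fun z => ‖u z‖ₑ ^ (p / q)) (volume.restrict (Metric.ball ξ r)) := by
    refine AEMeasurable.pow_const ?_ _
    exact ((hu.continuousOn.mono (Metric.ball_subset_closedBall.trans hD)).aemeasurable
      Metric.isOpen_ball.measurableSet).enorm
  have h1 := hC₁ e R hR hne (Metric.ball ξ r) Metric.isOpen_ball.measurableSet
    (fun z hz => ⟨hsub hz, hD (Metric.ball_subset_closedBall hz)⟩) _ hm
  have h2 := ENNReal.rpow_le_rpow (hC₂ u ξ r hr (hu.mono hD)) hq0.le
  have h3 : ∀ x : ℝ≥0∞, (x ^ (p / q)) ^ q = x ^ p := fun x => by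
    rw [← ENNReal.rpow_mul, div_mul_cancel₀ _ hq0.ne']
  simp only [h3] at h1
  rw [ENNReal.mul_rpow_of_nonneg _ _ hq0.le, ENNReal.mul_rpow_of_nonneg _ _ hq0.le, h3,
    ← ENNReal.ofReal_pow hr.le] at h2
  calc ENNReal.ofReal (r ^ 2) ^ q * (‖u ξ‖ₑ ^ p * weightedArea w (Metric.ball e R))
      = ‖u ξ‖ₑ ^ p * ENNReal.ofReal (r ^ 2) ^ q * weightedArea w (Metric.ball e R) := by ring
    _ ≤ C₂ ^ q * (∫⁻ z in Metric.ball ξ r, ‖u z‖ₑ ^ (p / q)) ^ q *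
          weightedArea w (Metric.ball e R) := by gcongr
    _ ≤ C₂ ^ q * (C₁ * volume (Metric.ball e R) ^ q *
          ∫⁻ z in Metric.ball ξ r, ‖u z‖ₑ ^ p ∂(weightedArea w)) := by
        rw [mul_assoc]; gcongr
    _ = _ := by
        rw [ENNReal.coe_mul, ENNReal.coe_rpow_of_nonneg _ hq0.le]; ring

/-! ### Geometry of dyadic Carleson boxes -/

/-- The index of the dyadic angular sector of generation `n` that contains `z`. -/
noncomputable def dyadicIndex (n : ℕ) (z : ℂ) : ℕ := ⌊2 ^ n * (1 - z.arg / Real.pi)⌋₊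

/-- The dyadic Carleson box of generation `n` and index `j`, cut off at height `2 ^ (-k)`. -/
def dyadicBox (n k j : ℕ) : Set ℂ :=
  {z | z ∈ unitDisc ∧ bdist z ≤ (1 / 2) ^ k ∧ dyadicIndex n z = j}

/-- The upper half of a dyadic Carleson box. -/
def dyadicTop (n j : ℕ) : Set ℂ :=
  {z | z ∈ unitDisc ∧ ((1 / 2) ^ (n + 1) < bdist z ∧ bdist z ≤ (1 / 2) ^ n) ∧ dyadicIndex n z = j}

/-- An endpoint of the boundary arc of a dyadic Carleson box. -/
noncomputable def dyadicPoint (n j : ℕ) : ℂ :=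
  Complex.exp ((Real.pi * (1 - j / 2 ^ n) : ℝ) * Complex.I)

/-- A disc centred at the unit circle containing a dyadic Carleson box. -/
noncomputable def dyadicDisc (n j : ℕ) : Set ℂ :=
  Metric.ball (dyadicPoint n j) (8 * (1 / 2) ^ n)

theorem one_sub_arg_div_pi_nonneg (z : ℂ) : 0 ≤ 1 - z.arg / Real.pi := by
  have := div_le_one_of_le₀ (Complex.arg_le_pi z) Real.pi_pos.le
  linarith

/-- Since `arg` takes values in `(-π, π]`, the normalized angle `1 - arg / π` lies in `[0, 2)`;
hence `2 ^ (n + 1)` sectors. -/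
theorem dyadicIndex_lt (n : ℕ) (z : ℂ) : dyadicIndex n z < 2 ^ (n + 1) := by
  have h0 := one_sub_arg_div_pi_nonneg z
  rw [dyadicIndex, Nat.floor_lt (by positivity)]
  have h1 : -1 < z.arg / Real.pi := by
    rw [lt_div_iff₀ Real.pi_pos]
    linarith [Complex.neg_pi_lt_arg z]
  push_cast
  rw [pow_succ]
  gcongr
  linarith

/-- The sectors are nested: this identifies the ancestor `m` generations up. -/
theorem dyadicIndex_add_div (n m : ℕ) (z : ℂ) :
    dyadicIndex (n + m) z / 2 ^ m = dyadicIndex n z := by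
  rw [dyadicIndex, dyadicIndex]
  have := Nat.floor_div_natCast (2 ^ (n + m) * (1 - z.arg / Real.pi)) (2 ^ m)
  rw [← this]
  congr 1
  push_cast
  rw [pow_add]
  field_simp

theorem measurable_dyadicIndex (n : ℕ) : Measurable (dyadicIndex n) := by
  refine Nat.measurable_floor.comp ?_
  exact (measurable_const.sub (Complex.measurable_arg.div_const _)).const_mul _

theorem continuous_bdist : Continuous bdist := by
  unfold bdist; fun_prop

theorem measurableSet_dyadicBox (n k j : ℕ) : MeasurableSet (dyadicBox n k j) := by
  refine Metric.isOpen_ball.measurableSet.inter (.inter ?_ ?_)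
  · exact measurableSet_le continuous_bdist.measurable measurable_const
  · exact measurable_dyadicIndex n (measurableSet_singleton j)

theorem measurableSet_dyadicTop (n j : ℕ) : MeasurableSet (dyadicTop n j) := by
  refine Metric.isOpen_ball.measurableSet.inter (.inter (.inter ?_ ?_) ?_)
  · exact measurableSet_lt measurable_const continuous_bdist.measurable
  · exact measurableSet_le continuous_bdist.measurable measurable_const
  · exact measurable_dyadicIndex n (measurableSet_singleton j)

/-- Radial displacement plus arc length. The free parameter `t` covers both `z` itself and the
points `rayPoint n z`. -/
theorem norm_mul_exp_sub_dyadicPoint_le (n : ℕ) (z : ℂ) (t : ℝ) :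
    ‖t * Complex.exp (z.arg * Complex.I) - dyadicPoint n (dyadicIndex n z)‖ ≤
      |1 - t| + Real.pi * (1 / 2) ^ n := by
  set α : ℝ := Real.pi * (1 - dyadicIndex n z / 2 ^ n) with hα
  have h0 := one_sub_arg_div_pi_nonneg z
  have hpi := Real.pi_pos
  have h1 : (dyadicIndex n z : ℝ) ≤ 2 ^ n * (1 - z.arg / Real.pi) := Nat.floor_le (by positivity)
  have h2 : 2 ^ n * (1 - z.arg / Real.pi) < dyadicIndex n z + 1 := Nat.lt_floor_add_one _
  have h3 : |z.arg - α| ≤ Real.pi * (1 / 2) ^ n := by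
    have h4 : z.arg - α = Real.pi * (1 / 2) ^ n *
        (dyadicIndex n z - 2 ^ n * (1 - z.arg / Real.pi)) := by
      rw [hα, div_pow, one_pow]
      field_simp
      ring
    rw [h4, abs_mul, abs_of_pos (by positivity)]
    refine mul_le_of_le_one_right (by positivity) ?_
    rw [abs_le]
    constructor <;> linarith
  have h5 : ‖Complex.exp (z.arg * Complex.I) - Complex.exp (α * Complex.I)‖ ≤ |z.arg - α| := by
    have h6 : Complex.exp (z.arg * Complex.I) - Complex.exp (α * Complex.I) =
        Complex.exp (α * Complex.I) * (Complex.exp (Complex.I * (z.arg - α : ℝ)) - 1) := by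
      rw [mul_sub, ← Complex.exp_add, mul_one]
      congr 2
      push_cast; ring
    rw [h6, norm_mul, Complex.norm_exp_ofReal_mul_I, one_mul, ← Real.norm_eq_abs]
    exact Real.norm_exp_I_mul_ofReal_sub_one_le
  calc ‖t * Complex.exp (z.arg * Complex.I) - dyadicPoint n (dyadicIndex n z)‖
      = ‖((t - 1 : ℝ) : ℂ) * Complex.exp (z.arg * Complex.I) +
          (Complex.exp (z.arg * Complex.I) - Complex.exp (α * Complex.I))‖ := by
        rw [dyadicPoint, ← hα]; congr 1; push_cast; ring
    _ ≤ |1 - t| + |z.arg - α| := by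
        refine (norm_add_le _ _).trans (add_le_add ?_ h5)
        rw [norm_mul, Complex.norm_exp_ofReal_mul_I, mul_one, Complex.norm_real, Real.norm_eq_abs,
          abs_sub_comm]
    _ ≤ _ := by gcongr

theorem norm_sub_dyadicPoint_le {n j k : ℕ} (hk : n ≤ k) {z : ℂ} (hz : z ∈ dyadicBox n k j) :
    ‖z - dyadicPoint n j‖ ≤ 5 * (1 / 2) ^ n := by
  obtain ⟨hD, hb, rfl⟩ := hz
  have h := norm_mul_exp_sub_dyadicPoint_le n z ‖z‖
  rw [Complex.norm_mul_exp_arg_mul_I] at h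
  have h1 : |1 - ‖z‖| ≤ (1 / 2) ^ n := by
    rw [abs_of_nonneg (by rw [mem_ball_zero_iff] at hD; linarith)]
    exact hb.trans (pow_le_pow_of_le_one (by norm_num) (by norm_num) hk)
  have h2 := Real.pi_le_four
  have h3 : (0 : ℝ) < (1 / 2) ^ n := by positivity
  nlinarith

theorem dyadicTop_subset_dyadicBox (n j : ℕ) : dyadicTop n j ⊆ dyadicBox n n j :=
  fun _ hz => ⟨hz.1, hz.2.1.2, hz.2.2⟩

theorem dyadicBox_subset_dyadicDisc (n j : ℕ) : dyadicBox n n j ⊆ dyadicDisc n j := by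
  intro z hz
  have := norm_sub_dyadicPoint_le le_rfl hz
  rw [dyadicDisc, mem_ball_iff_norm]
  have h3 : (0 : ℝ) < (1 / 2) ^ n := by positivity
  linarith

theorem closure_dyadicDisc_inter_sphere (n j : ℕ) :
    (closure (dyadicDisc n j) ∩ Metric.sphere 0 1).Nonempty := by
  refine ⟨dyadicPoint n j, subset_closure (Metric.mem_ball_self (by positivity)), ?_⟩
  rw [mem_sphere_zero_iff_norm, dyadicPoint, Complex.norm_exp_ofReal_mul_I]

theorem dyadicTop_union_dyadicBox_succ (n j : ℕ) :
    dyadicTop n j ∪ dyadicBox n (n + 1) j = dyadicBox n n j := by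
  ext z
  have h : ((1 : ℝ) / 2) ^ (n + 1) ≤ (1 / 2) ^ n :=
    pow_le_pow_of_le_one (by norm_num) (by norm_num) n.le_succ
  constructor
  · rintro (hz | hz)
    · exact dyadicTop_subset_dyadicBox n j hz
    · exact ⟨hz.1, hz.2.1.trans h, hz.2.2⟩
  · intro hz
    rcases lt_or_ge ((1 / 2) ^ (n + 1)) (bdist z) with h1 | h1
    · exact Or.inl ⟨hz.1, ⟨h1, hz.2.1⟩, hz.2.2⟩
    · exact Or.inr ⟨hz.1, h1, hz.2.2⟩

theorem disjoint_dyadicTop_dyadicBox_succ (n j : ℕ) :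
    Disjoint (dyadicTop n j) (dyadicBox n (n + 1) j) :=
  Set.disjoint_left.2 fun _ h1 h2 => absurd h2.2.1 (not_le.2 h1.2.1.1)

theorem le_volume_dyadicTop {n j : ℕ} (hj : j < 2 ^ (n + 1)) :
    ENNReal.ofReal (((1 / 2) ^ n) ^ 2 / 8) ≤ volume (dyadicTop n j) := by
  set h : ℝ := (1 / 2) ^ n with hh
  have hpos : 0 < h := by positivity
  have hle1 : h ≤ 1 := pow_le_one₀ (by norm_num) (by norm_num)
  have hpi := Real.pi_pos
  have h2n : (2 : ℝ) ^ n = h⁻¹ := by rw [hh, div_pow, one_pow, one_div, inv_inv]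
  set a : ℝ := Real.pi * (1 - (j + 1) * h) with ha
  set b : ℝ := Real.pi * (1 - j * h) with hb
  have hba : b - a = Real.pi * h := by rw [ha, hb]; ring
  have hjh : (j + 1) * h ≤ 2 := by
    have h1 : ((j + 1 : ℕ) : ℝ) ≤ ((2 ^ (n + 1) : ℕ) : ℝ) := by exact_mod_cast hj
    push_cast at h1
    rw [pow_succ, h2n] at h1
    calc (j + 1) * h ≤ h⁻¹ * 2 * h := by gcongr
      _ = 2 := by field_simp
  have haπ : -Real.pi ≤ a := by rw [ha]; nlinarith
  have hbπ : b ≤ Real.pi := by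
    rw [hb]
    have : 0 ≤ j * h := by positivity
    nlinarith
  -- Only the outer half of the radial range is used: there the radius exceeds `1 / 4` even for `n =
  -- 0`, which bounds the polar Jacobian from below.
  set Q : Set (ℝ × ℝ) := Set.Ioo (1 - 3 / 4 * h) (1 - h / 2) ×ˢ Set.Ioo a b with hQ
  have hQsub : Q ⊆ polarCoord.target := by
    rintro ⟨r, θ⟩ ⟨⟨hr1, hr2⟩, hθ1, hθ2⟩
    simp only at hr1 hr2 hθ1 hθ2
    rw [polarCoord_target]
    exact ⟨by simp only [Set.mem_Ioi]; linarith, by simp only [Set.mem_Ioo]; constructor <;> linarith⟩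
  rw [← setLIntegral_one, ← lintegral_indicator (measurableSet_dyadicTop n j),
    ← Complex.lintegral_comp_polarCoord_symm]
  calc ENNReal.ofReal (h ^ 2 / 8) ≤ ∫⁻ _ in Q, ENNReal.ofReal (1 / 4) := by
        rw [setLIntegral_const, hQ, Measure.volume_eq_prod, Measure.prod_prod, Real.volume_Ioo,
          Real.volume_Ioo, hba, ← ENNReal.ofReal_mul (by linarith),
          ← ENNReal.ofReal_mul (by norm_num)]
        refine ENNReal.ofReal_le_ofReal ?_
        nlinarith [Real.pi_gt_three, sq_nonneg h]
    _ ≤ ∫⁻ p in Q, ENNReal.ofReal p.1 •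
          (dyadicTop n j).indicator (fun _ => 1) (Complex.polarCoord.symm p) := by
        refine setLIntegral_mono' (measurableSet_Ioo.prod measurableSet_Ioo) ?_
        rintro ⟨r, θ⟩ ⟨⟨hr1, hr2⟩, hθ1, hθ2⟩
        simp only at hr1 hr2 hθ1 hθ2
        have hr0 : 0 < r := by linarith
        have hnorm : ‖Complex.polarCoord.symm (r, θ)‖ = r := by
          rw [Complex.norm_polarCoord_symm, abs_of_pos hr0]
        have harg : (Complex.polarCoord.symm (r, θ)).arg = θ := by
          rw [Complex.polarCoord_symm_apply]
          simp only [Complex.ofReal_cos, Complex.ofReal_sin]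
          exact Complex.arg_mul_cos_add_sin_mul_I hr0 ⟨by linarith, by linarith⟩
        have hmem : Complex.polarCoord.symm (r, θ) ∈ dyadicTop n j := by
          refine ⟨?_, ⟨?_, ?_⟩, ?_⟩
          · rw [mem_ball_zero_iff, hnorm]; linarith
          · rw [bdist, hnorm, pow_succ, ← hh]; linarith
          · rw [bdist, hnorm, ← hh]; linarith
          · rw [dyadicIndex, harg, h2n, Nat.floor_eq_iff]
            · have e1 : h⁻¹ * (1 - θ / Real.pi) = (Real.pi - θ) / (Real.pi * h) := by field_simp
              rw [e1, le_div_iff₀ (by positivity), div_lt_iff₀ (by positivity)]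
              constructor
              · rw [hb] at hθ2; linarith
              · rw [ha] at hθ1; linarith
            · have : θ / Real.pi ≤ 1 := div_le_one_of_le₀ (by linarith) hpi.le
              have : 0 ≤ 1 - θ / Real.pi := by linarith
              positivity
        rw [Set.indicator_of_mem hmem, smul_eq_mul, mul_one]
        exact ENNReal.ofReal_le_ofReal (by simp only; linarith)
    _ ≤ _ := lintegral_mono_set hQsub

theorem dyadicBox_eq_empty {n k j : ℕ} (hj : 2 ^ (n + 1) ≤ j) : dyadicBox n k j = ∅ := by
  ext z
  simp only [Set.mem_empty_iff_false, iff_false]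
  rintro ⟨-, -, rfl⟩
  exact absurd (dyadicIndex_lt n z) (not_lt.2 hj)

theorem volume_ball_mul {c : ℂ} {a h : ℝ} (ha : 0 ≤ a) (hh : 0 ≤ h) :
    volume (Metric.ball c (a * h)) = ENNReal.ofReal (Real.pi * a ^ 2 * h ^ 2) := by
  have hp : (NNReal.pi : ℝ≥0∞) = ENNReal.ofReal Real.pi := by
    rw [ENNReal.ofReal, ← NNReal.coe_real_pi, Real.toNNReal_coe]
  rw [Complex.volume_ball, hp, ← ENNReal.ofReal_pow (by positivity),
    ← ENNReal.ofReal_mul (by positivity)]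
  congr 1; ring

/-! ### Decay of weighted area towards the circle -/

/-- The top half and the disc have comparable areas, with ratio at most `512 π`, so the `A_∞`
inequality compares their weighted areas. -/
theorem IsBekolleBonami.exists_dyadicDisc_le_dyadicTop {q : ℝ} (hq : 1 < q) {w : ℂ → ℝ}
    (hw : IsBekolleBonami q w) :
    ∃ K : ℝ≥0, ∀ n j : ℕ, j < 2 ^ (n + 1) →
      weightedArea w (dyadicDisc n j) ≤ K * weightedArea w (dyadicTop n j) := by
  obtain ⟨C, hC⟩ := hw.exists_volume_rpow_mul_le hq
  have hq0 : 0 < q := by linarith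
  refine ⟨C * (512 * Real.pi).toNNReal ^ q, fun n j hj => ?_⟩
  set h : ℝ := (1 / 2) ^ n with hh
  have hpos : 0 < h := by positivity
  have h1 := hC (dyadicPoint n j) (8 * h) (by positivity) (closure_dyadicDisc_inter_sphere n j)
    (dyadicTop n j) (measurableSet_dyadicTop n j) fun z hz =>
      ⟨dyadicBox_subset_dyadicDisc n j (dyadicTop_subset_dyadicBox n j hz), hz.1⟩
  rw [volume_ball_mul (by norm_num) hpos.le] at h1
  have hx0 : ENNReal.ofReal (h ^ 2 / 8) ^ q ≠ 0 := by
    simp [ENNReal.rpow_eq_zero_iff, hq0, hpos]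
  have hxt : ENNReal.ofReal (h ^ 2 / 8) ^ q ≠ ⊤ :=
    ENNReal.rpow_ne_top_of_nonneg hq0.le ENNReal.ofReal_ne_top
  rw [← ENNReal.mul_le_mul_iff_right hx0 hxt]
  calc ENNReal.ofReal (h ^ 2 / 8) ^ q * weightedArea w (dyadicDisc n j)
      ≤ volume (dyadicTop n j) ^ q * weightedArea w (dyadicDisc n j) := by
        gcongr; exact le_volume_dyadicTop hj
    _ ≤ _ := h1
    _ = _ := by
      have h2 : Real.pi * 8 ^ 2 * h ^ 2 = 512 * Real.pi * (h ^ 2 / 8) := by ring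
      rw [h2, ENNReal.ofReal_mul (by positivity), ENNReal.mul_rpow_of_nonneg _ _ hq0.le,
        ENNReal.coe_mul, ENNReal.coe_rpow_of_nonneg _ hq0.le]
      simp only [ENNReal.ofReal]
      ring

/-- The weighted area of the part of a dyadic Carleson box close to the unit circle decays
geometrically. -/
theorem IsBekolleBonami.exists_dyadicBox_decay {q : ℝ} (hq : 1 < q) {w : ℂ → ℝ}
    (hw : IsBekolleBonami q w) :
    ∃ ρ : ℝ≥0, ρ < 1 ∧ ∀ n m j : ℕ, weightedArea w (dyadicBox n (n + m) j) ≤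
      ρ ^ m * weightedArea w (dyadicBox n n j) := by
  obtain ⟨K, hK⟩ := hw.exists_dyadicDisc_le_dyadicTop hq
  refine ⟨K / (1 + K), by rw [div_lt_one (by positivity)]; simp, ?_⟩
  -- If the bottom has mass `b ≤ K * t`, with `t` the mass of the top, then `(1 + K) * b ≤ K * (t +
  -- b)`.
  set ρ : ℝ≥0 := K / (1 + K) with hρ
  have h1 : ∀ n j : ℕ, weightedArea w (dyadicBox n (n + 1) j) ≤
      ρ * weightedArea w (dyadicBox n n j) := by
    intro n j
    rcases lt_or_ge j (2 ^ (n + 1)) with hj | hj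
    · have h2 : weightedArea w (dyadicBox n (n + 1) j) ≤ K * weightedArea w (dyadicTop n j) := by
        refine le_trans (measure_mono ?_) (hK n j hj)
        refine Set.Subset.trans ?_ (dyadicBox_subset_dyadicDisc n j)
        rw [← dyadicTop_union_dyadicBox_succ]
        exact Set.subset_union_right
      have h3 : weightedArea w (dyadicBox n n j) =
          weightedArea w (dyadicTop n j) + weightedArea w (dyadicBox n (n + 1) j) := by
        rw [← dyadicTop_union_dyadicBox_succ, measure_union (disjoint_dyadicTop_dyadicBox_succ n j)
          (measurableSet_dyadicBox _ _ _)]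
      have h4 : (1 + K : ℝ≥0∞) * weightedArea w (dyadicBox n (n + 1) j) ≤
          K * weightedArea w (dyadicBox n n j) := by
        rw [h3, add_mul, one_mul, mul_add]
        gcongr
      rw [hρ, ENNReal.coe_div (by positivity), ENNReal.coe_add, ENNReal.coe_one]
      rw [← ENNReal.mul_le_mul_iff_right (a := (1 + K : ℝ≥0∞)) (by simp) (by simp)]
      refine h4.trans (le_of_eq ?_)
      rw [← mul_assoc, ENNReal.mul_div_cancel (by simp) (by simp)]
    · simp [dyadicBox_eq_empty hj]
  intro n m j
  induction m with
  | zero => simp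
  | succ m ih =>
    -- At depth `n + m` the box is split into its descendants of generation `n + m`; the one-step
    -- decay `h1` applies to each.
    have hdec : ∀ k, dyadicBox n k j =
        ⋃ i ∈ {i : ℕ | i / 2 ^ m = j}, dyadicBox (n + m) k i := by
      intro k
      ext z
      simp only [Set.mem_iUnion, exists_prop, Set.mem_ofPred_eq]
      constructor
      · rintro ⟨hz1, hz2, hz3⟩
        exact ⟨dyadicIndex (n + m) z, by rw [dyadicIndex_add_div, hz3], hz1, hz2, rfl⟩
      · rintro ⟨i, hi, hz1, hz2, rfl⟩
        exact ⟨hz1, hz2, by rw [← dyadicIndex_add_div n m, hi]⟩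
    have hmeas : ∀ k, weightedArea w (dyadicBox n k j) =
        ∑' i : {i : ℕ | i / 2 ^ m = j}, weightedArea w (dyadicBox (n + m) k i) := by
      intro k
      rw [hdec k]
      refine measure_biUnion (Set.to_countable _) ?_ fun i _ => measurableSet_dyadicBox _ _ _
      intro a _ b _ hab
      exact Set.disjoint_left.2 fun z hz1 hz2 => hab (hz1.2.2.symm.trans hz2.2.2)
    calc weightedArea w (dyadicBox n (n + (m + 1)) j)
        = ∑' i : {i : ℕ | i / 2 ^ m = j}, weightedArea w (dyadicBox (n + m) (n + m + 1) i) :=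
          hmeas _
      _ ≤ ∑' i : {i : ℕ | i / 2 ^ m = j}, ρ * weightedArea w (dyadicBox (n + m) (n + m) i) :=
          ENNReal.tsum_le_tsum fun i => h1 _ _
      _ = ρ * weightedArea w (dyadicBox n (n + m) j) := by rw [ENNReal.tsum_mul_left, ← hmeas]
      _ ≤ ρ * (ρ ^ m * weightedArea w (dyadicBox n n j)) := by gcongr
      _ = _ := by ring

/-! ### Harmonic conjugates along rays -/

/-- Borel–Carathéodory for `f - f ζ`, whose real part is at most `2 * M`. With radii `h / 2` and `3
/ 4 * h` the factor is `4`, and `ε` keeps the bound positive when `M = 0`. -/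
theorem norm_sub_le_of_re_le {f : ℂ → ℂ} {ζ z : ℂ} {h M : ℝ} (hh : 0 < h) (hM : 0 ≤ M)
    (hf : DifferentiableOn ℂ f (Metric.ball ζ (3 / 4 * h)))
    (hre : ∀ ξ ∈ Metric.ball ζ (3 / 4 * h), |(f ξ).re| ≤ M) (hz : ‖z - ζ‖ ≤ h / 2) :
    ‖f z - f ζ‖ ≤ 8 * M := by
  refine le_of_forall_pos_le_add fun ε hε => ?_
  have hmaps : Set.MapsTo (fun x : ℂ => ζ + x) (Metric.ball 0 (3 / 4 * h))
      (Metric.ball ζ (3 / 4 * h)) := fun x hx => by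
    simpa [mem_ball_iff_norm] using hx
  have hz' : ‖z - ζ‖ < 3 / 4 * h := by linarith
  have key := Complex.borelCaratheodory_zero (f := fun x => f (ζ + x) - f ζ) (M := 2 * M + ε / 4)
    (R := 3 / 4 * h) (z := z - ζ) (by positivity)
    ((hf.comp (by fun_prop) hmaps).sub_const _) (fun x hx => by
      have h1 := (abs_le.1 (hre _ (hmaps hx))).2
      have h2 := (abs_le.1 (hre ζ (Metric.mem_ball_self (by positivity)))).1
      simp only [Set.mem_ofPred_eq, Complex.sub_re]
      linarith) (by positivity) (by simpa using hz') (by simp)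
  simp only [add_sub_cancel] at key
  refine key.trans ?_
  rw [div_le_iff₀ (by linarith)]
  nlinarith

theorem IsHarmonicConjugate.enorm_sub_le {u v : ℂ → ℝ} (hv : IsHarmonicConjugate u v) {ζ z : ℂ}
    {h : ℝ} (hh : 0 < h) (hsub : Metric.ball ζ (3 / 4 * h) ⊆ unitDisc) {M : ℝ≥0∞}
    (hM : ∀ ξ ∈ Metric.ball ζ (3 / 4 * h), ‖u ξ‖ₑ ≤ M) (hz : ‖z - ζ‖ ≤ h / 2) :
    ‖v z - v ζ‖ₑ ≤ 8 * M := by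
  rcases eq_or_ne M ⊤ with rfl | hMt
  · simp
  lift M to ℝ≥0 using hMt
  have h1 := norm_sub_le_of_re_le (z := z) hh M.2 (hv.1.mono hsub) (fun ξ hξ => by
    have := hM ξ hξ
    rw [enorm_le_coe, ← NNReal.coe_le_coe, coe_nnnorm, Real.norm_eq_abs] at this
    simpa using this) hz
  have h2 : |v z - v ζ| ≤ 8 * M := by
    refine le_trans ?_ h1
    convert! Complex.abs_im_le_norm _ using 2
    simp
  have h3 : ‖v z - v ζ‖₊ ≤ 8 * M := by
    rw [← NNReal.coe_le_coe, coe_nnnorm, Real.norm_eq_abs]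
    exact h2
  rw [enorm_eq_nnnorm]
  exact_mod_cast h3

/-- The point at distance `2 ^ (-n)` from the unit circle on the ray through `z`. -/
noncomputable def rayPoint (n : ℕ) (z : ℂ) : ℂ :=
  (1 - (1 / 2) ^ n : ℝ) * Complex.exp (z.arg * Complex.I)

theorem pow_half_le_one (n : ℕ) : ((1 : ℝ) / 2) ^ n ≤ 1 := pow_le_one₀ (by norm_num) (by norm_num)

theorem bdist_rayPoint (n : ℕ) (z : ℂ) : bdist (rayPoint n z) = (1 / 2) ^ n := by
  rw [bdist, rayPoint, norm_mul, Complex.norm_exp_ofReal_mul_I, mul_one, Complex.norm_real,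
    Real.norm_eq_abs, abs_of_nonneg (by linarith [pow_half_le_one n])]
  ring

theorem abs_bdist_sub_le (z ξ : ℂ) : |bdist z - bdist ξ| ≤ ‖z - ξ‖ := by
  rw [bdist, bdist, show 1 - ‖z‖ - (1 - ‖ξ‖) = -(‖z‖ - ‖ξ‖) by ring, abs_neg]
  exact abs_norm_sub_norm_le z ξ

theorem mem_unitDisc_of_bdist_pos {z : ℂ} (h : 0 < bdist z) : z ∈ unitDisc := by
  rw [mem_ball_zero_iff]
  rw [bdist] at h
  linarith

/-- A harmonic conjugate is controlled along a ray by the size of the function near the ray. -/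
theorem IsHarmonicConjugate.enorm_le_sum {u v : ℂ → ℝ} (hv : IsHarmonicConjugate u v) {z : ℂ}
    {N : ℕ} (hz1 : (1 / 2) ^ (N + 1) < bdist z) (hz2 : bdist z ≤ (1 / 2) ^ N) {M : ℕ → ℝ≥0∞}
    (hM : ∀ n ≤ N, ∀ ξ ∈ Metric.ball (rayPoint n z) (3 / 4 * (1 / 2) ^ n), ‖u ξ‖ₑ ≤ M n) :
    ‖v z‖ₑ ≤ 8 * ∑ n ∈ Finset.range (N + 1), M n := by
  have hsub : ∀ n, Metric.ball (rayPoint n z) (3 / 4 * (1 / 2) ^ n) ⊆ unitDisc := by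
    intro n ξ hξ
    have h1 := (abs_le.1 (abs_bdist_sub_le ξ (rayPoint n z))).1
    rw [bdist_rayPoint] at h1
    rw [mem_ball_iff_norm] at hξ
    have : (0 : ℝ) < (1 / 2) ^ n := by positivity
    exact mem_unitDisc_of_bdist_pos (by linarith)
  have hdiff : ∀ (t : ℝ) (n : ℕ), |t - (1 - (1 / 2) ^ n)| ≤ (1 / 2) ^ n / 2 →
      ‖t * Complex.exp (z.arg * Complex.I) - rayPoint n z‖ ≤ (1 / 2) ^ n / 2 := by
    intro t n ht
    rw [rayPoint, ← sub_mul, norm_mul, Complex.norm_exp_ofReal_mul_I, mul_one,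
      ← Complex.ofReal_sub, Complex.norm_real, Real.norm_eq_abs]
    exact ht
  have hchain : ∀ n ≤ N, ‖v (rayPoint n z)‖ₑ ≤ 8 * ∑ k ∈ Finset.range n, M k := by
    intro n
    induction n with
    -- `rayPoint 0 z` is the origin, where `v` is normalized to vanish.
    | zero => intro _; simp [rayPoint, hv.2]
    | succ n ih =>
      intro hn
      have hp : (0 : ℝ) < (1 / 2) ^ n := by positivity
      have h1 := hv.enorm_sub_le hp (hsub n) (hM n (by omega)) (z := rayPoint (n + 1) z)
        (hdiff _ n (by rw [pow_succ, abs_of_nonneg (by linarith)]; linarith))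
      rw [Finset.sum_range_succ, mul_add]
      calc ‖v (rayPoint (n + 1) z)‖ₑ
          = ‖v (rayPoint n z) + (v (rayPoint (n + 1) z) - v (rayPoint n z))‖ₑ := by congr 1; ring
        _ ≤ _ := (enorm_add_le _ _).trans (add_le_add (ih (by omega)) h1)
  have hp : (0 : ℝ) < (1 / 2) ^ N := by positivity
  have h1 := hv.enorm_sub_le hp (hsub N) (hM N le_rfl) (z := z) (by
    have h2 := hdiff ‖z‖ N (by
      rw [bdist] at hz1 hz2
      rw [pow_succ] at hz1
      rw [abs_of_nonneg (by linarith)]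
      linarith)
    rwa [Complex.norm_mul_exp_arg_mul_I] at h2)
  rw [Finset.sum_range_succ, mul_add]
  calc ‖v z‖ₑ = ‖v (rayPoint N z) + (v z - v (rayPoint N z))‖ₑ := by congr 1; ring
    _ ≤ _ := (enorm_add_le _ _).trans (add_le_add (hchain N le_rfl) h1)

/-! ### Local weighted estimates and bounded overlap -/

/-- A neighbourhood, in the hyperbolic sense, of the upper half of a dyadic Carleson box. -/
def dyadicNhd (n j : ℕ) : Set ℂ :=
  dyadicDisc n j ∩ {z | (1 / 2) ^ n / 8 ≤ bdist z ∧ bdist z ≤ 2 * (1 / 2) ^ n}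

theorem measurableSet_dyadicNhd (n j : ℕ) : MeasurableSet (dyadicNhd n j) := by
  refine Metric.isOpen_ball.measurableSet.inter (.inter ?_ ?_)
  · exact measurableSet_le measurable_const continuous_bdist.measurable
  · exact measurableSet_le continuous_bdist.measurable measurable_const

/-- A smaller neighbourhood of the upper half of a dyadic Carleson box. -/
def dyadicCore (n j : ℕ) : Set ℂ :=
  {z | (1 / 2) ^ n / 4 < bdist z ∧ bdist z < 7 / 4 * (1 / 2) ^ n ∧
    ‖z - dyadicPoint n j‖ < 6 * (1 / 2) ^ n}

/-- This fixes the constants of `dyadicCore`: in units of `2 ^ (-n)`, the boundary distance is `1 ±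
3 / 4`, and the distance to `dyadicPoint` is below `3 / 4 + 1 + π < 6`. -/
theorem ball_rayPoint_subset_dyadicCore (n : ℕ) (z : ℂ) :
    Metric.ball (rayPoint n z) (3 / 4 * (1 / 2) ^ n) ⊆ dyadicCore n (dyadicIndex n z) := by
  intro ξ hξ
  have hp : (0 : ℝ) < (1 / 2) ^ n := by positivity
  have h1 := abs_le.1 (abs_bdist_sub_le ξ (rayPoint n z))
  rw [bdist_rayPoint] at h1
  rw [mem_ball_iff_norm] at hξ
  refine ⟨by linarith, by linarith, ?_⟩
  have h2 := norm_mul_exp_sub_dyadicPoint_le n z (1 - (1 / 2) ^ n)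
  rw [← rayPoint, sub_sub_cancel, abs_of_pos hp] at h2
  have h3 := norm_sub_le_norm_sub_add_norm_sub ξ (rayPoint n z) (dyadicPoint n (dyadicIndex n z))
  nlinarith [Real.pi_le_four]

theorem ball_subset_dyadicNhd {n j : ℕ} {ξ : ℂ} (hξ : ξ ∈ dyadicCore n j) :
    Metric.ball ξ (1 / 8 * (1 / 2) ^ n) ⊆ dyadicNhd n j := by
  intro z hz
  obtain ⟨h1, h2, h3⟩ := hξ
  have hp : (0 : ℝ) < (1 / 2) ^ n := by positivity
  have h4 := abs_le.1 (abs_bdist_sub_le z ξ)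
  rw [mem_ball_iff_norm] at hz
  have h5 := norm_sub_le_norm_sub_add_norm_sub z ξ (dyadicPoint n j)
  refine ⟨?_, ?_, ?_⟩
  · rw [dyadicDisc, mem_ball_iff_norm]; linarith
  · linarith
  · linarith

/-- The disc of radius `2 ^ (-n) / 8` about any point of the core stays in `dyadicNhd` and has area
comparable to that of `dyadicDisc`, so the local estimate is uniform in the point. -/
theorem IsBekolleBonami.exists_iSup_dyadicCore_le {p q : ℝ} (hp : 0 < p) (hq : 1 < q) {w : ℂ → ℝ}
    (hw : IsBekolleBonami q w) :
    ∃ K : ℝ≥0, ∀ u : ℂ → ℝ, InnerProductSpace.HarmonicOnNhd u unitDisc → ∀ n j : ℕ,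
      (⨆ ξ ∈ dyadicCore n j, ‖u ξ‖ₑ ^ p) * weightedArea w (dyadicDisc n j) ≤
        K * ∫⁻ z in dyadicNhd n j, ‖u z‖ₑ ^ p ∂(weightedArea w) := by
  obtain ⟨C, hC⟩ := hw.exists_enorm_rpow_mul_le hp hq
  have hq0 : 0 < q := by linarith
  refine ⟨C * (4096 * Real.pi).toNNReal ^ q, fun u hu n j => ?_⟩
  simp only [ENNReal.iSup_mul]
  refine iSup₂_le fun ξ hξ => ?_
  set h : ℝ := (1 / 2) ^ n with hh
  have hpos : 0 < h := by positivity
  have hball := ball_subset_dyadicNhd hξ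
  have h1 := hC (dyadicPoint n j) (8 * h) (by positivity) (closure_dyadicDisc_inter_sphere n j)
    u ξ (1 / 8 * h) (by positivity) (hball.trans Set.inter_subset_left) (fun z hz => by
      have h4 := abs_le.1 (abs_bdist_sub_le z ξ)
      have h5 := hξ.1
      rw [mem_closedBall_iff_norm] at hz
      exact mem_unitDisc_of_bdist_pos (by linarith)) hu
  rw [volume_ball_mul (by norm_num) hpos.le] at h1
  have hx0 : ENNReal.ofReal ((1 / 8 * h) ^ 2) ^ q ≠ 0 := by
    simp [ENNReal.rpow_eq_zero_iff, hq0, hpos.ne']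
  have hxt : ENNReal.ofReal ((1 / 8 * h) ^ 2) ^ q ≠ ⊤ :=
    ENNReal.rpow_ne_top_of_nonneg hq0.le ENNReal.ofReal_ne_top
  rw [← ENNReal.mul_le_mul_iff_right hx0 hxt]
  refine h1.trans ?_
  have h2 : Real.pi * 8 ^ 2 * h ^ 2 = 4096 * Real.pi * (1 / 8 * h) ^ 2 := by ring
  rw [h2, ENNReal.ofReal_mul (by positivity), ENNReal.mul_rpow_of_nonneg _ _ hq0.le,
    ENNReal.coe_mul, ENNReal.coe_rpow_of_nonneg _ hq0.le]
  calc _ = ENNReal.ofReal ((1 / 8 * h) ^ 2) ^ q * (C * ENNReal.ofReal (4096 * Real.pi) ^ q *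
        ∫⁻ z in Metric.ball ξ (1 / 8 * h), ‖u z‖ₑ ^ p ∂(weightedArea w)) := by ring
    _ ≤ _ := by
      gcongr
      simp only [ENNReal.ofReal]
      rfl

/-- Packing: the discs containing `z` have disjoint top halves of area at least `h ^ 2 / 8`, all
inside the disc of radius `(5 + 8) * h` about `z`. Using `π ≤ 4`, their number is at most `8 * 4 *
13 ^ 2 = 5408`. -/
theorem sum_indicator_dyadicDisc_le (n : ℕ) (z : ℂ) :
    ∑ j ∈ Finset.range (2 ^ (n + 1)), (dyadicDisc n j).indicator (1 : ℂ → ℝ≥0∞) z ≤ 5408 := by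
  classical
  set h : ℝ := (1 / 2) ^ n with hh
  have hpos : 0 < h := by positivity
  set s := (Finset.range (2 ^ (n + 1))).filter fun j => z ∈ dyadicDisc n j with hs
  have hsum : ∑ j ∈ Finset.range (2 ^ (n + 1)), (dyadicDisc n j).indicator (1 : ℂ → ℝ≥0∞) z =
      s.card := by
    simp [Set.indicator_apply, hs]
  have hx0 : ENNReal.ofReal (h ^ 2 / 8) ≠ 0 := by simp [hpos]
  rw [hsum, ← ENNReal.mul_le_mul_iff_left hx0 ENNReal.ofReal_ne_top]
  calc (s.card : ℝ≥0∞) * ENNReal.ofReal (h ^ 2 / 8)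
      = ∑ j ∈ s, ENNReal.ofReal (h ^ 2 / 8) := by simp
    _ ≤ ∑ j ∈ s, volume (dyadicTop n j) := Finset.sum_le_sum fun j hj =>
        le_volume_dyadicTop (Finset.mem_range.1 (Finset.mem_filter.1 hj).1)
    _ = volume (⋃ j ∈ s, dyadicTop n j) := by
        rw [measure_biUnion_finset _ fun j _ => measurableSet_dyadicTop n j]
        intro a _ b _ hab
        exact Set.disjoint_left.2 fun x h1 h2 => hab (h1.2.2.symm.trans h2.2.2)
    _ ≤ volume (Metric.ball z (13 * h)) := by
        refine measure_mono (Set.iUnion₂_subset fun j hj x hx => ?_)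
        have h1 := norm_sub_dyadicPoint_le le_rfl (dyadicTop_subset_dyadicBox n j hx)
        have h2 := (Finset.mem_filter.1 hj).2
        rw [dyadicDisc, mem_ball_iff_norm'] at h2
        rw [mem_ball_iff_norm]
        have h3 := norm_sub_le_norm_sub_add_norm_sub x (dyadicPoint n j) z
        linarith
    _ ≤ 5408 * ENNReal.ofReal (h ^ 2 / 8) := by
        rw [volume_ball_mul (by norm_num) hpos.le, show (5408 : ℝ≥0∞) = ENNReal.ofReal 5408 by simp,
          ← ENNReal.ofReal_mul (by norm_num)]
        refine ENNReal.ofReal_le_ofReal ?_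
        nlinarith [Real.pi_le_four, sq_nonneg h]

/-- The bounds on `x` differ by a factor `16 = 2 ^ 4`, which leaves room for five consecutive values
of `n`. -/
theorem tsum_indicator_annulus_le (x : ℝ) :
    ∑' n : ℕ, {n : ℕ | (1 / 2) ^ n / 8 ≤ x ∧ x ≤ 2 * (1 / 2) ^ n}.indicator (1 : ℕ → ℝ≥0∞) n ≤
      5 := by
  classical
  set s := {n : ℕ | (1 / 2 : ℝ) ^ n / 8 ≤ x ∧ x ≤ 2 * (1 / 2) ^ n} with hs
  rcases s.eq_empty_or_nonempty with h | h
  · simp [h]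
  · have h1 := Nat.find_spec h
    set m := Nat.find h with hm
    have hsub : ∀ n ∉ Finset.Ico m (m + 5), s.indicator (1 : ℕ → ℝ≥0∞) n = 0 := by
      intro n hn
      refine Set.indicator_of_notMem (fun hns => hn ?_) _
      rw [Finset.mem_Ico]
      refine ⟨Nat.find_min' h hns, ?_⟩
      by_contra! hc
      have h2 : ((1 : ℝ) / 2) ^ n ≤ (1 / 2) ^ (m + 5) :=
        pow_le_pow_of_le_one (by norm_num) (by norm_num) hc
      have h3 := h1.1
      have h4 := hns.2
      have hp : (0 : ℝ) < (1 / 2) ^ m := by positivity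
      rw [pow_add] at h2
      norm_num at h2
      linarith
    rw [tsum_eq_sum hsub]
    calc ∑ n ∈ Finset.Ico m (m + 5), s.indicator (1 : ℕ → ℝ≥0∞) n
        ≤ ∑ n ∈ Finset.Ico m (m + 5), 1 := Finset.sum_le_sum fun n _ =>
          Set.indicator_le_self' (by simp) n
      _ = 5 := by simp

/-- The neighbourhoods of the dyadic Carleson boxes have bounded overlap. -/
theorem tsum_sum_setLIntegral_dyadicNhd_le (μ : Measure ℂ) {F : ℂ → ℝ≥0∞} (hF : AEMeasurable F μ) :
    ∑' n : ℕ, ∑ j ∈ Finset.range (2 ^ (n + 1)), ∫⁻ z in dyadicNhd n j, F z ∂μ ≤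
      (5 * 5408) * ∫⁻ z, F z ∂μ := by
  classical
  have hpt : ∀ z, ∑' n : ℕ, ∑ j ∈ Finset.range (2 ^ (n + 1)), (dyadicNhd n j).indicator F z ≤
      (5 * 5408) * F z := by
    intro z
    have h1 : ∀ n j, (dyadicNhd n j).indicator F z =
        {n : ℕ | (1 / 2) ^ n / 8 ≤ bdist z ∧ bdist z ≤ 2 * (1 / 2) ^ n}.indicator
          (1 : ℕ → ℝ≥0∞) n * ((dyadicDisc n j).indicator (1 : ℂ → ℝ≥0∞) z * F z) := by
      intro n j
      by_cases ha : z ∈ dyadicDisc n j <;>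
      by_cases hb : (1 / 2) ^ n / 8 ≤ bdist z ∧ bdist z ≤ 2 * (1 / 2) ^ n <;>
      simp [dyadicNhd, Set.indicator_apply, ha]
    simp only [h1, ← Finset.mul_sum, ← Finset.sum_mul]
    calc _ ≤ ∑' n : ℕ, {n : ℕ | (1 / 2) ^ n / 8 ≤ bdist z ∧ bdist z ≤ 2 * (1 / 2) ^ n}.indicator
          (1 : ℕ → ℝ≥0∞) n * (5408 * F z) := by
          refine ENNReal.tsum_le_tsum fun n => ?_
          gcongr
          exact sum_indicator_dyadicDisc_le n z
      _ ≤ _ := by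
          rw [ENNReal.tsum_mul_right, mul_assoc]
          gcongr
          exact tsum_indicator_annulus_le _
  calc _ = ∫⁻ z, ∑' n : ℕ, ∑ j ∈ Finset.range (2 ^ (n + 1)), (dyadicNhd n j).indicator F z ∂μ := by
        have hm : ∀ n j, AEMeasurable ((dyadicNhd n j).indicator F) μ := fun n j =>
          hF.indicator (measurableSet_dyadicNhd n j)
        rw [lintegral_tsum fun n => Finset.aemeasurable_fun_sum _ fun j _ => hm n j]
        refine tsum_congr fun n => ?_
        rw [lintegral_finsetSum' _ fun j _ => hm n j]
        refine Finset.sum_congr rfl fun j _ => ?_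
        rw [lintegral_indicator (measurableSet_dyadicNhd n j)]
    _ ≤ ∫⁻ z, (5 * 5408) * F z ∂μ := lintegral_mono hpt
    _ = _ := lintegral_const_mul' _ _ (by simp [ENNReal.mul_eq_top])

/-! ### Discrete Hardy inequality and summation over layers -/

/-- Each term of the right-hand sum `S` is at most `S`, so `X n ^ (1 / p) ≤ κ ^ (N - n) * S ^ (1 /
p)` with `κ = θ ^ (1 / p) < 1`, and a geometric series remains. This treats `p < 1` and `p ≥ 1`
alike. -/
theorem exists_sum_rpow_le {p : ℝ} (hp : 0 < p) {θ : ℝ≥0} (hθ0 : 0 < θ) (hθ1 : θ < 1) :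
    ∃ C : ℝ≥0, ∀ (N : ℕ) (X : ℕ → ℝ≥0∞),
      (∑ n ∈ Finset.range (N + 1), X n ^ (1 / p)) ^ p ≤
        C * ∑ n ∈ Finset.range (N + 1), ((θ : ℝ≥0∞) ^ (N - n))⁻¹ * X n := by
  have hp' : 0 < 1 / p := by positivity
  set κ : ℝ≥0 := θ ^ (1 / p) with hκ
  have hκ1 : κ < 1 := NNReal.rpow_lt_one hθ1 hp'
  refine ⟨((1 - κ)⁻¹) ^ p, fun N X => ?_⟩
  set S := ∑ n ∈ Finset.range (N + 1), ((θ : ℝ≥0∞) ^ (N - n))⁻¹ * X n with hS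
  have h1 : ∀ n ∈ Finset.range (N + 1), X n ^ (1 / p) ≤ (κ : ℝ≥0∞) ^ (N - n) * S ^ (1 / p) := by
    intro n hn
    have h2 : ((θ : ℝ≥0∞) ^ (N - n))⁻¹ * X n ≤ S :=
      Finset.single_le_sum (f := fun n => ((θ : ℝ≥0∞) ^ (N - n))⁻¹ * X n) (fun _ _ => zero_le) hn
    have h3 : X n ≤ (θ : ℝ≥0∞) ^ (N - n) * S := by
      calc X n = (θ : ℝ≥0∞) ^ (N - n) * (((θ : ℝ≥0∞) ^ (N - n))⁻¹ * X n) := by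
            rw [← mul_assoc, ENNReal.mul_inv_cancel (by simp [hθ0.ne']) (by simp), one_mul]
        _ ≤ _ := by gcongr
    refine (ENNReal.rpow_le_rpow h3 hp'.le).trans (le_of_eq ?_)
    rw [ENNReal.mul_rpow_of_nonneg _ _ hp'.le, hκ, ENNReal.coe_rpow_of_nonneg _ hp'.le]
    congr 1
    rw [← ENNReal.rpow_natCast, ← ENNReal.rpow_natCast, ← ENNReal.rpow_mul, ← ENNReal.rpow_mul,
      mul_comm]
  have h4 : ∑ n ∈ Finset.range (N + 1), X n ^ (1 / p) ≤ (1 - κ : ℝ≥0∞)⁻¹ * S ^ (1 / p) := by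
    calc _ ≤ ∑ n ∈ Finset.range (N + 1), (κ : ℝ≥0∞) ^ (N - n) * S ^ (1 / p) :=
          Finset.sum_le_sum h1
      _ = (∑ n ∈ Finset.range (N + 1), (κ : ℝ≥0∞) ^ n) * S ^ (1 / p) := by
          rw [← Finset.sum_mul]
          congr 1
          exact Finset.sum_range_reflect (fun n => (κ : ℝ≥0∞) ^ n) (N + 1)
      _ ≤ _ := by
          gcongr
          rw [← ENNReal.tsum_geometric]
          exact ENNReal.sum_le_tsum _
  refine (ENNReal.rpow_le_rpow h4 hp.le).trans (le_of_eq ?_)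
  rw [ENNReal.mul_rpow_of_nonneg _ _ hp.le, ← ENNReal.rpow_mul, one_div_mul_cancel hp.ne',
    ENNReal.rpow_one, ENNReal.coe_rpow_of_nonneg _ hp.le,
    ENNReal.coe_inv (tsub_pos_of_lt hκ1).ne', ENNReal.coe_sub, ENNReal.coe_one]

theorem ENNReal.tsum_sum_range_succ_eq (g : ℕ → ℕ → ℝ≥0∞) :
    ∑' N : ℕ, ∑ n ∈ Finset.range (N + 1), g n (N - n) = ∑' (n : ℕ) (k : ℕ), g n k := by
  simp only [← Finset.Nat.sum_antidiagonal_eq_sum_range_succ g]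
  rw [← ENNReal.tsum_prod, ← Equiv.tsum_eq Finset.HasAntidiagonal.sigmaAntidiagonalEquivProd, ENNReal.tsum_sigma']
  refine tsum_congr fun N => ?_
  rw [tsum_fintype, ← Finset.sum_coe_sort]
  rfl

theorem exists_mem_annulus {z : ℂ} (hz : z ∈ unitDisc) :
    ∃ N : ℕ, (1 / 2) ^ (N + 1) < bdist z ∧ bdist z ≤ (1 / 2) ^ N := by
  rw [mem_ball_zero_iff] at hz
  exact exists_nat_pow_near_of_lt_one (x := bdist z) (y := 1 / 2) (by rw [bdist]; linarith)
    (by rw [bdist]; linarith [norm_nonneg z]) (by norm_num) (by norm_num)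

/-- Integration, over points of bounded height, of a function that is constant on dyadic boxes. -/
theorem setLIntegral_dyadicIndex_le (μ : Measure ℂ) (X : ℕ → ℝ≥0∞) (n N : ℕ) :
    ∫⁻ z in {z | z ∈ unitDisc ∧ bdist z ≤ (1 / 2) ^ N}, X (dyadicIndex n z) ∂μ ≤
      ∑ j ∈ Finset.range (2 ^ (n + 1)), X j * μ (dyadicBox n N j) := by
  have hm : MeasurableSet {z | z ∈ unitDisc ∧ bdist z ≤ (1 / 2) ^ N} :=
    Metric.isOpen_ball.measurableSet.inter
      (measurableSet_le continuous_bdist.measurable measurable_const)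
  calc _ ≤ ∫⁻ z in {z | z ∈ unitDisc ∧ bdist z ≤ (1 / 2) ^ N},
        ∑ j ∈ Finset.range (2 ^ (n + 1)), (dyadicBox n N j).indicator (fun _ => X j) z ∂μ := by
        refine setLIntegral_mono' hm fun z hz => ?_
        have h1 : z ∈ dyadicBox n N (dyadicIndex n z) := ⟨hz.1, hz.2, rfl⟩
        calc X (dyadicIndex n z)
            = (dyadicBox n N (dyadicIndex n z)).indicator (fun _ => X (dyadicIndex n z)) z := by
              rw [Set.indicator_of_mem h1]
          _ ≤ _ := Finset.single_le_sum
              (f := fun j => (dyadicBox n N j).indicator (fun _ => X j) z) (fun _ _ => zero_le)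
              (Finset.mem_range.2 (dyadicIndex_lt n z))
    _ ≤ ∫⁻ z, ∑ j ∈ Finset.range (2 ^ (n + 1)), (dyadicBox n N j).indicator (fun _ => X j) z ∂μ :=
        setLIntegral_le_lintegral _ _
    _ = _ := by
        rw [lintegral_finsetSum _ fun j _ =>
          measurable_const.indicator (measurableSet_dyadicBox n N j)]
        refine Finset.sum_congr rfl fun j _ => ?_
        rw [lintegral_indicator_const (measurableSet_dyadicBox n N j)]

/-- The weighted norm inequality for harmonic conjugates, in `lintegral` form. -/
theorem IsBekolleBonami.exists_lintegral_conjugate_le {p q : ℝ} (hp : 0 < p) (hq : 1 < q)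
    {w : ℂ → ℝ} (hw : IsBekolleBonami q w) :
    ∃ C : ℝ≥0, ∀ u v : ℂ → ℝ, InnerProductSpace.HarmonicOnNhd u unitDisc →
      AEMeasurable u (weightedArea w) → IsHarmonicConjugate u v →
      ∫⁻ z in unitDisc, ‖v z‖ₑ ^ p ∂(weightedArea w) ≤
        C * ∫⁻ z, ‖u z‖ₑ ^ p ∂(weightedArea w) := by
  obtain ⟨ρ, hρ1, hρ⟩ := hw.exists_dyadicBox_decay hq
  obtain ⟨K, hK⟩ := hw.exists_iSup_dyadicCore_le hp hq
  -- Of the decay `ρ ≤ θ ^ 2`, one factor `θ` pays for the Hardy inequality and the other makes the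
  -- sum over layers converge. The `max` keeps `θ` positive.
  set θ : ℝ≥0 := NNReal.sqrt (max ρ (1 / 2)) with hθ
  have hθsq : θ ^ 2 = max ρ (1 / 2) := NNReal.sq_sqrt _
  have hθ0 : 0 < θ := NNReal.sqrt_pos.2 (lt_max_of_lt_right (by norm_num))
  have hθ1 : θ < 1 := by
    have h1 : max ρ (1 / 2) < 1 := max_lt hρ1 (by rw [div_lt_one (by norm_num)]; norm_num)
    simpa [hθ] using NNReal.sqrt_lt_sqrt.2 h1
  obtain ⟨C, hC⟩ := exists_sum_rpow_le hp hθ0 hθ1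
  refine ⟨8 ^ p * C * (1 - θ)⁻¹ * (K * (5 * 5408)), fun u v hu hum hv => ?_⟩
  set μ := weightedArea w with hμ
  set X : ℕ → ℕ → ℝ≥0∞ := fun n j => ⨆ ξ ∈ dyadicCore n j, ‖u ξ‖ₑ ^ p with hX
  set A : ℕ → Set ℂ := fun N => {z | z ∈ unitDisc ∧ bdist z ≤ (1 / 2) ^ N} with hA
  set A' : ℕ → Set ℂ := fun N => A N ∩ {z | (1 / 2) ^ (N + 1) < bdist z} with hA'
  have hA'm : ∀ N, MeasurableSet (A' N) := fun N =>
    (Metric.isOpen_ball.measurableSet.inter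
      (measurableSet_le continuous_bdist.measurable measurable_const)).inter
      (measurableSet_lt measurable_const continuous_bdist.measurable)
  have hcover : unitDisc ⊆ ⋃ N, A' N := fun z hz => by
    obtain ⟨N, h1, h2⟩ := exists_mem_annulus hz
    exact Set.mem_iUnion.2 ⟨N, ⟨hz, h2⟩, h1⟩
  have hpt : ∀ N, ∀ z ∈ A' N, ‖v z‖ₑ ^ p ≤ 8 ^ p * (C *
      ∑ n ∈ Finset.range (N + 1), ((θ : ℝ≥0∞) ^ (N - n))⁻¹ * X n (dyadicIndex n z)) := by
    intro N z hz
    have h1 : ‖v z‖ₑ ≤ 8 * ∑ n ∈ Finset.range (N + 1), X n (dyadicIndex n z) ^ (1 / p) := by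
      refine hv.enorm_le_sum hz.2 hz.1.2 fun n _ ξ hξ => ?_
      have h2 : ‖u ξ‖ₑ ^ p ≤ X n (dyadicIndex n z) :=
        le_iSup₂ (f := fun ξ (_ : ξ ∈ dyadicCore n (dyadicIndex n z)) => ‖u ξ‖ₑ ^ p) ξ
          (ball_rayPoint_subset_dyadicCore n z hξ)
      rw [one_div]
      exact (ENNReal.le_rpow_inv_iff hp).2 h2
    refine (ENNReal.rpow_le_rpow h1 hp.le).trans ?_
    rw [ENNReal.mul_rpow_of_nonneg _ _ hp.le]
    gcongr
    exact hC N _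
  set Y : ℕ → ℝ≥0∞ := fun n => ∑ j ∈ Finset.range (2 ^ (n + 1)), X n j * μ (dyadicBox n n j)
    with hY
  have hlayer : ∀ N, ∫⁻ z in A' N, ‖v z‖ₑ ^ p ∂μ ≤
      8 ^ p * (C * ∑ n ∈ Finset.range (N + 1), (θ : ℝ≥0∞) ^ (N - n) * Y n) := by
    intro N
    have hmeas : ∀ n, Measurable fun z => ((θ : ℝ≥0∞) ^ (N - n))⁻¹ * X n (dyadicIndex n z) :=
      fun n => ((measurable_from_nat (f := X n)).comp (measurable_dyadicIndex n)).const_mul _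
    refine (setLIntegral_mono' (hA'm N) (hpt N)).trans ?_
    rw [lintegral_const_mul' _ _ (ENNReal.rpow_ne_top_of_nonneg hp.le (by simp)),
      lintegral_const_mul' _ _ ENNReal.coe_ne_top, lintegral_finsetSum _ fun n _ => hmeas n]
    gcongr with n hn
    have hnN : n ≤ N := Nat.lt_succ_iff.1 (Finset.mem_range.1 hn)
    have hθN : (θ : ℝ≥0∞) ^ (N - n) ≠ 0 := by simp [hθ0.ne']
    rw [lintegral_const_mul' _ _ (ENNReal.inv_ne_top.2 hθN)]
    have h1 : ∫⁻ z in A' N, X n (dyadicIndex n z) ∂μ ≤ ((θ : ℝ≥0∞) ^ (N - n)) ^ 2 * Y n := by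
      refine (lintegral_mono_set Set.inter_subset_left).trans
        ((setLIntegral_dyadicIndex_le μ (X n) n N).trans ?_)
      rw [hY, Finset.mul_sum]
      refine Finset.sum_le_sum fun j _ => ?_
      have h2 := hρ n (N - n) j
      rw [Nat.add_sub_cancel' hnN] at h2
      have h3 : (ρ : ℝ≥0∞) ^ (N - n) ≤ ((θ : ℝ≥0∞) ^ (N - n)) ^ 2 := by
        rw [← pow_mul, mul_comm, pow_mul]
        have : (ρ : ℝ≥0∞) ≤ (θ : ℝ≥0∞) ^ 2 := by
          rw [← ENNReal.coe_pow, hθsq]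
          exact_mod_cast le_max_left _ _
        gcongr
      calc X n j * μ (dyadicBox n N j)
          ≤ X n j * (((θ : ℝ≥0∞) ^ (N - n)) ^ 2 * μ (dyadicBox n n j)) := by
            gcongr
            exact h2.trans (by gcongr)
        _ = _ := by ring
    calc ((θ : ℝ≥0∞) ^ (N - n))⁻¹ * ∫⁻ z in A' N, X n (dyadicIndex n z) ∂μ
        ≤ ((θ : ℝ≥0∞) ^ (N - n))⁻¹ * (((θ : ℝ≥0∞) ^ (N - n)) ^ 2 * Y n) := by gcongr
      _ = (((θ : ℝ≥0∞) ^ (N - n))⁻¹ * (θ : ℝ≥0∞) ^ (N - n)) * ((θ : ℝ≥0∞) ^ (N - n) * Y n) := by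
          ring
      _ = _ := by rw [ENNReal.inv_mul_cancel hθN (by simp), one_mul]
  have hYsum : ∑' n, Y n ≤ K * (5 * 5408) * ∫⁻ z, ‖u z‖ₑ ^ p ∂μ := by
    calc ∑' n, Y n ≤ ∑' n : ℕ, ∑ j ∈ Finset.range (2 ^ (n + 1)),
          K * ∫⁻ z in dyadicNhd n j, ‖u z‖ₑ ^ p ∂μ := by
          refine ENNReal.tsum_le_tsum fun n => Finset.sum_le_sum fun j _ => ?_
          refine le_trans ?_ (hK u hu n j)
          gcongr
          exact dyadicBox_subset_dyadicDisc n j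
      _ ≤ _ := by
          simp only [← Finset.mul_sum]
          rw [ENNReal.tsum_mul_left, mul_assoc]
          gcongr
          exact tsum_sum_setLIntegral_dyadicNhd_le μ (hum.enorm.pow_const p)
  calc ∫⁻ z in unitDisc, ‖v z‖ₑ ^ p ∂μ
      ≤ ∫⁻ z in ⋃ N, A' N, ‖v z‖ₑ ^ p ∂μ := lintegral_mono_set hcover
    _ ≤ ∑' N, ∫⁻ z in A' N, ‖v z‖ₑ ^ p ∂μ := lintegral_iUnion_le _ _
    _ ≤ ∑' N, 8 ^ p * (C * ∑ n ∈ Finset.range (N + 1), (θ : ℝ≥0∞) ^ (N - n) * Y n) :=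
        ENNReal.tsum_le_tsum hlayer
    -- Summing over `N` with `k = N - n` separates the geometric series in `k` from the sum of `Y
    -- n`.
    _ = 8 ^ p * (C * ((1 - θ : ℝ≥0∞)⁻¹ * ∑' n, Y n)) := by
        rw [ENNReal.tsum_mul_left, ENNReal.tsum_mul_left,
          ENNReal.tsum_sum_range_succ_eq fun n k => (θ : ℝ≥0∞) ^ k * Y n]
        simp only [ENNReal.tsum_mul_right, ENNReal.tsum_mul_left, ENNReal.tsum_geometric]
    _ ≤ 8 ^ p * (C * ((1 - θ : ℝ≥0∞)⁻¹ * (K * (5 * 5408) * ∫⁻ z, ‖u z‖ₑ ^ p ∂μ))) := by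
        gcongr
    _ = _ := by
        push_cast
        rw [ENNReal.coe_rpow_of_nonneg _ hp.le, ENNReal.coe_inv (tsub_pos_of_lt hθ1).ne',
          ENNReal.coe_sub]
        push_cast
        ring

/-! ### Existence of the conjugate and the norm bound -/

/-- Every harmonic function on the disc has a normalized harmonic conjugate. -/
theorem exists_isHarmonicConjugate {u : ℂ → ℝ}
    (hu : InnerProductSpace.HarmonicOnNhd u unitDisc) : ∃ v : ℂ → ℝ, IsHarmonicConjugate u v := by
  obtain ⟨F, hF, hre⟩ := hu.exists_analyticOnNhd_ball_re_eq
  refine ⟨fun z => (F z).im - (F 0).im, ?_, sub_self _⟩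
  refine (hF.differentiableOn.sub_const (Complex.I * ((F 0).im : ℂ))).congr fun z hz => ?_
  have h1 : u z = (F z).re := (hre hz).symm
  rw [h1]
  push_cast
  rw [mul_sub, add_sub_assoc']
  congr 1
  rw [mul_comm]
  exact Complex.re_add_im (F z)

theorem IsHarmonicConjugate.harmonicOnNhd {u v : ℂ → ℝ} (hv : IsHarmonicConjugate u v) :
    InnerProductSpace.HarmonicOnNhd v unitDisc := by
  have han := hv.1.analyticOnNhd Metric.isOpen_ball
  intro z hz
  have := (han z hz).harmonicAt_im
  convert! this using 1
  ext x
  simp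

theorem weightedArea_absolutelyContinuous (w : ℂ → ℝ) :
    weightedArea w ≪ volume.restrict unitDisc :=
  withDensity_absolutelyContinuous _ _

/-- On a Bekollé–Bonami weighted harmonic Bergman space the harmonic conjugation operator is
bounded. The Bekollé–Bonami condition alone already yields this: by
`IsBekolleBonami.exists_enorm_rpow_mul_le` the shift operators in `hcomp` are not needed. -/
theorem mainTheorem1 (p : ℝ) (hp : 0 < p) (w : ℂ → ℝ)
    (hw : ∃ q : ℝ, 1 < q ∧ IsBekolleBonami q w)
    (hcomp : ∀ᶠ η : ℝ in 𝓝[>] 0,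
      CompositionBounded p w (radialShift η) ∧ CompositionBounded p w (angularShift η)) :
    ∃ C : ℝ≥0, ∀ u : ℂ → ℝ, MemHarmonicBergman p w u →
      (∃ v : ℂ → ℝ, IsHarmonicConjugate u v) ∧
      ∀ v : ℂ → ℝ, IsHarmonicConjugate u v →
        MemHarmonicBergman p w v ∧
          eLpNorm v (ENNReal.ofReal p) (weightedArea w) ≤
            C * eLpNorm u (ENNReal.ofReal p) (weightedArea w) := by
  obtain ⟨q, hq, hBB⟩ := hw
  obtain ⟨C, hC⟩ := hBB.exists_lintegral_conjugate_le hp hq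
  refine ⟨C ^ (1 / p), fun u hu => ⟨exists_isHarmonicConjugate hu.1, fun v hv => ?_⟩⟩
  have hp0 : ENNReal.ofReal p ≠ 0 := by simpa using hp
  have hpt : ENNReal.ofReal p ≠ ⊤ := ENNReal.ofReal_ne_top
  have hp' : 0 ≤ 1 / p := by positivity
  have hvh := hv.harmonicOnNhd
  have hle : eLpNorm v (ENNReal.ofReal p) (weightedArea w) ≤
      (C ^ (1 / p) : ℝ≥0) * eLpNorm u (ENNReal.ofReal p) (weightedArea w) := by
    rw [eLpNorm_eq_lintegral_rpow_enorm_toReal hp0 hpt,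
      eLpNorm_eq_lintegral_rpow_enorm_toReal hp0 hpt, ENNReal.toReal_ofReal hp.le,
      ENNReal.coe_rpow_of_nonneg _ hp', ← ENNReal.mul_rpow_of_nonneg _ _ hp']
    refine ENNReal.rpow_le_rpow ?_ hp'
    refine le_trans (le_of_eq ?_) (hC u v hu.1 hu.2.1.aemeasurable hv)
    -- `weightedArea w` is carried by the disc, so restricting to `unitDisc` changes nothing.
    rw [Measure.restrict_eq_self_of_ae_mem]
    exact (weightedArea_absolutelyContinuous w).ae_le
      (ae_restrict_mem Metric.isOpen_ball.measurableSet)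
  refine ⟨⟨hvh, ?_, ?_⟩, hle⟩
  · exact (hvh.continuousOn.aestronglyMeasurable Metric.isOpen_ball.measurableSet).mono_ac
      (weightedArea_absolutelyContinuous w)
  · exact hle.trans_lt (ENNReal.mul_lt_top ENNReal.coe_lt_top hu.2.2)
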